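/- Let $\mathbb F_q$ be a finite field with $q$ elements and characteristic $p$, $A=\mathbb F_q[\theta]$, $K=\mathbb F_q(\theta)$, and let $K^{1/p^\infty}$ be the field of all $x$ in an algebraic closure of $K$ with $x^{p^i}\in K$ for some $i\ge 0$. Let $s\ge 1$ be an integer with $s\equiv 1\pmod{q-1}$, put $m=\frac{s-1}{q-1}$ and $\boldsymbol F_s=\mathbb F_q(t_1,\dots,t_s)$, and let $$\mathcal A_s=\prod_P\frac{\boldsymbol F_s[\theta]}{P\boldsymbol F_s[\theta]}\Big/\bigoplus_P\frac{\boldsymbol F_s[\theta]}{P\boldsymbol F_s[\theta]},$$ where $P$ runs over the monic irreducible polynomials of $A$. Let $\iota:K^{1/p^\infty}(t_1,\dots,t_s)\to\mathcal A_s$ be the embedding of $\boldsymbol F_s$-algebras that sends $r\in K$ to the class of its reductions modulo almost all $P$, and $x\in K^{1/p^\infty}$ with $x^{p^i}=y\in K$ to the unique $p^i$-th root of $\iota(y)$ in $\prod_P\frac{A}{PA}\big/\bigoplus_P\frac{A}{PA}\subset\mathcal A_s$. (The field $K^{1/p^\infty}(t_1,\dots,t_s)$ is the fraction field of $K^{1/p^\infty}\otimes_{\mathbb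 F_q}\boldsymbol F_s$.) For $d\ge 1$ put $$F_d(1;s)=\sum_{i=0}^{d-1}\ \sum_{\substack{a\in A\text{ monic}\\ \deg a=i}}\frac{a(t_1)\cdots a(t_s)}{a}\in K[t_1,\dots,t_s],$$ where $a(t)$ is $a$ with $\theta$ replaced by $t$, and define $$Z_{\mathcal A}(1;s)=\big(F_{\deg P}(1;s)\bmod P\big)_P\in\mathcal A_s,\qquad \widehat\pi=\Big(-\frac1{P'}\Big)_P\in\mathcal A_s^\times,\qquad \widehat\omega(t_i)=\Big(\frac1{P(t_i)}\Big)_P\in\mathcal A_s^\times,$$ with $P'$ the derivative of $P$ with respect to $\theta$. Finally put $b_n(t)=\prod_{i=0}^{n-1}(t-\theta^{q^i})$, $l_n=\prod_{i=1}^{n}(\theta-\theta^{q^i})$ and $\Pi_{s,d}=l_{d-1}^{-1}\,b_{d-m}(t_1)\cdots b_{d-m}(t_s)$ for $d\ge\max\{1,m\}$. Theorem. There is exactly one rational fraction $\mathbb H_s\in K(Y,t_1,\dots,t_s)$ that is defined at $Y=\theta^{q^{d-m}}$ and satisfies $F_d(1;s)=\Pi_{s,d}\cdot\mathbb H_s|_{Y=\theta^{q^{d-m}}}$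 for all $d\ge\max\{1,m\}$. It is also defined at $Y=\theta^{q^{-m}}$, the element $$\mu_{1,s}=-\frac{\mathbb H_s|_{Y=\theta^{q^{-m}}}}{\prod_{i=1}^s\prod_{j=1}^m\big(t_i-\theta^{q^{-j}}\big)}\in K^{1/p^\infty}(t_1,\dots,t_s)$$ is non-zero, and $$Z_{\mathcal A}(1;s)=\frac{\widehat\pi}{\widehat\omega(t_1)\cdots\widehat\omega(t_s)}\,\iota(\mu_{1,s}).$$ In particular $Z_{\mathcal A}(1;s)\in\mathcal A_s^\times$. -/

import Mathlib

open Polynomial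

noncomputable section

namespace FinZeta

variable (F : Type*) [Field F]

/-! ### The rings `A`, `K`, `F_s`, `K^{1/p^∞}` and their rational function fields

`F` is the finite field with `q` elements, `A = F[X]` (the variable `X` is `θ`) and `K = RatFunc F`. -/

/-- The primes of `A = F[θ]`: monic irreducible polynomials. -/
abbrev Primes : Type _ := {P : F[X] // P.Monic ∧ Irreducible P}

/-- The field `F_s = F(t_1, …, t_s)`. -/
abbrev Fs (s : ℕ) : Type _ := FractionRing (MvPolynomial (Fin s) F)

/-- `K^{1/p^∞}`: the elements `x` of an algebraic closure of `K` with `x ^ (p ^ n) ∈ K`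
for some `n`. -/
abbrev Kperf : Type _ := perfectClosure (RatFunc F) (AlgebraicClosure (RatFunc F))

/-- The field `K^{1/p^∞}(t_1, …, t_s)`. -/
abbrev PerfFrac (s : ℕ) : Type _ := FractionRing (MvPolynomial (Fin s) (Kperf F))

/-- The image in `K^{1/p^∞}` of a polynomial in `θ`. -/
def toKperf : F[X] →+* Kperf F :=
  (algebraMap (RatFunc F) (Kperf F)).comp (algebraMap F[X] (RatFunc F))

/-! ### The ring `∏_P E[θ]/P / ⊕_P E[θ]/P` -/

section Residues

variable (E : Type*) [Field E] [Algebra F E]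

/-- `E[θ] / P E[θ]`. -/
def Res (P : Primes F) : Type _ := E[X] ⧸ Ideal.span {P.1.map (algebraMap F E)}

instance (P : Primes F) : CommRing (Res F E P) :=
  inferInstanceAs (CommRing (E[X] ⧸ Ideal.span {P.1.map (algebraMap F E)}))

/-- The direct sum `⊕_P E[θ]/P` as an ideal of the product: families with finite support. -/
def directSumIdeal : Ideal (∀ P : Primes F, Res F E P) where
  carrier := {x | {P | x P ≠ 0}.Finite}
  zero_mem' := by simp
  add_mem' {x y} hx hy := by
    refine (Set.Finite.union hx hy).subset fun P hP => ?_
    by_contra h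
    simp only [Set.mem_union, Set.mem_ofPred_eq, not_or, not_not] at h
    exact hP (by simp [h.1, h.2])
  smul_mem' c x hx := by
    refine Set.Finite.subset hx fun P hP h => hP ?_
    simp only [smul_eq_mul, Pi.mul_apply, h, mul_zero]

/-- The quotient of the product by the direct sum. -/
def ResRing : Type _ := (∀ P : Primes F, Res F E P) ⧸ directSumIdeal F E

instance : CommRing (ResRing F E) :=
  inferInstanceAs (CommRing ((∀ P : Primes F, Res F E P) ⧸ directSumIdeal F E))

variable {F E} in
/-- The class of a polynomial in `E[θ]/P`. -/
def resMk (P : Primes F) : E[X] →+* Res F E P := Ideal.Quotient.mk _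

/-- The class of a family of residues. -/
def famMk : (∀ P : Primes F, Res F E P) →+* ResRing F E := Ideal.Quotient.mk _

/-- The diagonal map `E[θ] → ∏_P E[θ]/P / ⊕_P E[θ]/P`. -/
def diag : E[X] →+* ResRing F E :=
  (famMk F E).comp (RingHom.pi fun P => resMk P)

variable {F E}

theorem famMk_eq_iff {x y : ∀ P : Primes F, Res F E P} :
    famMk F E x = famMk F E y ↔ {P | x P ≠ y P}.Finite := by
  refine Ideal.Quotient.eq.trans ?_
  change {P | (x - y) P ≠ 0}.Finite ↔ _
  simp only [Pi.sub_apply, ne_eq, sub_eq_zero]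

theorem primes_eq_of_dvd {P Q : Primes F} {g : E[X]} (hg : ¬ IsUnit g)
    (hP : g ∣ P.1.map (algebraMap F E)) (hQ : g ∣ Q.1.map (algebraMap F E)) : P = Q := by
  by_contra h
  have hc : IsCoprime P.1 Q.1 := by
    rw [P.2.2.coprime_iff_not_dvd]
    intro hd
    apply h
    have := (P.2.2.associated_of_dvd Q.2.2 hd)
    exact Subtype.ext (Polynomial.eq_of_monic_of_associated P.2.1 Q.2.1 this)
  have hc' : IsCoprime (P.1.map (algebraMap F E)) (Q.1.map (algebraMap F E)) :=
    hc.map (Polynomial.mapRingHom (algebraMap F E))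
  exact hg (hc'.isUnit_of_dvd' hP hQ)

theorem finite_not_coprime {f : E[X]} (hf : f ≠ 0) :
    {P : Primes F | ¬ IsCoprime f (P.1.map (algebraMap F E))}.Finite := by
  classical
  have key : ∀ P : Primes F, ¬ IsCoprime f (P.1.map (algebraMap F E)) →
      ∃ g ∈ (UniqueFactorizationMonoid.normalizedFactors f).toFinset,
        g ∣ P.1.map (algebraMap F E) ∧ ¬ IsUnit g := by
    intro P hP
    obtain ⟨g, hg, hgf, hgP⟩ : ∃ g : E[X], Irreducible g ∧ g ∣ f ∧
        g ∣ P.1.map (algebraMap F E) := by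
      by_contra hn
      push Not at hn
      exact hP (isCoprime_of_irreducible_dvd (fun h => hf h.1) fun g hg h1 h2 => hn g hg h1 h2)
    obtain ⟨g', hg', ha⟩ := UniqueFactorizationMonoid.exists_mem_normalizedFactors_of_dvd hf hg hgf
    refine ⟨g', Multiset.mem_toFinset.2 hg', ha.symm.dvd.trans hgP, ?_⟩
    intro h
    exact hg.not_isUnit (ha.isUnit_iff.mpr h)
  refine Set.Finite.of_finite_fibers
    (f := fun P : Primes F => if h : ¬ IsCoprime f (P.1.map (algebraMap F E)) then
      (key P h).choose else 0) ?_ ?_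
  · refine ((UniqueFactorizationMonoid.normalizedFactors f).toFinset.finite_toSet).subset ?_
    rintro _ ⟨P, hP, rfl⟩
    have hP' : ¬ IsCoprime f (P.1.map (algebraMap F E)) := hP
    simp only [hP', not_false_eq_true, dif_pos]
    exact (key P hP').choose_spec.1
  · intro g _
    refine Set.Subsingleton.finite ?_
    rintro P ⟨hP, hPg⟩ Q ⟨hQ, hQg⟩
    have hP' : ¬ IsCoprime f (P.1.map (algebraMap F E)) := hP
    have hQ' : ¬ IsCoprime f (Q.1.map (algebraMap F E)) := hQ
    simp only [hP', hQ', not_false_eq_true, dif_pos, Set.mem_preimage,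
      Set.mem_singleton_iff] at hPg hQg
    have h1 := (key P hP').choose_spec.2
    have h2 := (key Q hQ').choose_spec.2
    rw [hPg] at h1
    rw [hQg] at h2
    exact primes_eq_of_dvd h1.2 h1.1 h2.1

theorem resMk_isUnit {f : E[X]} {P : Primes F} (h : IsCoprime f (P.1.map (algebraMap F E))) :
    IsUnit (resMk P f : Res F E P) := by
  obtain ⟨a, b, hab⟩ := h
  refine IsUnit.of_mul_eq_one (resMk P a) ?_
  rw [← map_mul, ← map_one (resMk P)]
  refine Ideal.Quotient.eq.2 (Ideal.mem_span_singleton.2 ?_)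
  exact ⟨-b, by linear_combination hab⟩

theorem diag_isUnit {f : E[X]} (hf : f ≠ 0) : IsUnit (diag F E f) := by
  refine IsUnit.of_mul_eq_one (famMk F E fun P => Ring.inverse (resMk P f)) ?_
  change famMk F E _ * famMk F E _ = famMk F E 1
  rw [← map_mul, famMk_eq_iff]
  refine (finite_not_coprime hf).subset fun P hP hc => hP ?_
  exact Ring.mul_inverse_cancel _ (resMk_isUnit hc)

end Residues

/-! ### The embedding `ι` -/

section Base

variable {F}

/-- The residue field maps `F[θ]/P → E[θ]/P`. -/
def resMap (E : Type*) [Field E] [Algebra F E] (P : Primes F) : Res F F P →+* Res F E P :=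
  Ideal.quotientMap _ (Polynomial.mapRingHom (algebraMap F E)) (by
    rw [Ideal.span_le, Set.singleton_subset_iff]
    exact Ideal.mem_span_singleton.2 (by simp))

/-- The map `∏_P F[θ]/P / ⊕_P F[θ]/P → ∏_P E[θ]/P / ⊕_P E[θ]/P`. -/
def resRingMap (E : Type*) [Field E] [Algebra F E] : ResRing F F →+* ResRing F E :=
  Ideal.quotientMap _
    (RingHom.pi fun P => (resMap E P).comp (Pi.evalRingHom (fun P => Res F F P) P)) (by
      intro x hx
      refine Set.Finite.subset hx fun P hP h => hP ?_
      change resMap E P (x P) = 0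
      rw [h, map_zero])

theorem resRingMap_diag (E : Type*) [Field E] [Algebra F E] (f : F[X]) :
    resRingMap E (diag F F f) = diag F E (f.map (algebraMap F E)) := rfl

/-- `K → ∏_P F[θ]/P / ⊕_P F[θ]/P`: reduction modulo almost all `P`. -/
def redK : RatFunc F →+* ResRing F F :=
  IsLocalization.lift (M := nonZeroDivisors F[X]) (g := diag F F)
    fun y => diag_isUnit (nonZeroDivisors.ne_zero y.2)

theorem exists_prime_not_dvd {Q : F[X]} (hQ : Q ≠ 0) : ∃ P : Primes F, ¬ P.1 ∣ Q := by
  classical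
  by_contra! hn
  have hd : (X * Q + 1).degree = (X * Q).degree := by
    refine degree_add_eq_left_of_degree_lt ?_
    rw [degree_one, degree_mul, degree_X, degree_eq_natDegree hQ]
    exact_mod_cast (by omega : 0 < 1 + Q.natDegree)
  have hdf : 0 < (X * Q + 1).degree := by
    rw [hd, degree_mul, degree_X, degree_eq_natDegree hQ]
    exact_mod_cast (by omega : 0 < 1 + Q.natDegree)
  obtain ⟨g, hg, hgf⟩ := exists_irreducible_of_degree_pos hdf
  have ha : Associated (normalize g) g := normalize_associated g
  have h1 : normalize g ∣ Q := hn ⟨normalize g, monic_normalize hg.ne_zero, ha.symm.irreducible hg⟩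
  have h3 : g ∣ 1 := (dvd_add_right ((ha.symm.dvd.trans h1).mul_left X)).1 hgf
  exact hg.not_isUnit (isUnit_of_dvd_one h3)

theorem infinite_primes : Infinite (Primes F) := by
  by_contra hn
  rw [not_infinite_iff_finite] at hn
  have := Fintype.ofFinite (Primes F)
  obtain ⟨P, hP⟩ := exists_prime_not_dvd (Q := ∏ P : Primes F, P.1)
    (Finset.prod_ne_zero_iff.2 fun P _ => P.2.2.ne_zero)
  exact hP (Finset.dvd_prod_of_mem (fun P : Primes F => P.1) (Finset.mem_univ P))

theorem resRing_nontrivial : Nontrivial (ResRing F F) := by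
  refine ⟨⟨1, 0, fun h => ?_⟩⟩
  have h' : famMk F F 1 = famMk F F 0 := h
  rw [famMk_eq_iff] at h'
  have := infinite_primes (F := F)
  refine Set.infinite_univ (α := Primes F) (h'.subset fun P _ hP => ?_)
  have h1 : resMk P (1 : F[X]) = resMk P 0 := hP
  have h2 := Ideal.mem_span_singleton.1 (Ideal.Quotient.eq.1 h1)
  rw [sub_zero, Algebra.algebraMap_self, Polynomial.map_id] at h2
  exact P.2.2.not_isUnit (isUnit_of_dvd_one h2)

theorem resRing_charP (p : ℕ) [CharP F p] : CharP (ResRing F F) p :=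
  have := resRing_nontrivial (F := F)
  charP_of_injective_ringHom ((diag F F).comp C).injective p

variable [Finite F]

theorem res_frobenius (p : ℕ) [Fact p.Prime] [CharP F p] (P : Primes F) :
    Function.Bijective fun x : Res F F P => x ^ p := by
  have hmax : (Ideal.span {P.1.map (algebraMap F F)}).IsMaximal := by
    rw [Algebra.algebraMap_self, Polynomial.map_id]
    exact PrincipalIdealRing.isMaximal_of_irreducible P.2.2
  have hdom : IsDomain (Res F F P) :=
    inferInstanceAs (IsDomain (F[X] ⧸ Ideal.span {P.1.map (algebraMap F F)}))
  have : CharP (Res F F P) p := charP_of_injective_ringHom ((resMk P).comp C).injective p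
  have : ExpChar (Res F F P) p := ExpChar.prime Fact.out
  have hm : (P.1.map (algebraMap F F)).Monic := P.2.1.map _
  have : Finite (Res F F P) := by
    have : Module.Finite F (AdjoinRoot (P.1.map (algebraMap F F))) := hm.finite_adjoinRoot
    exact Module.finite_of_finite (M := AdjoinRoot (P.1.map (algebraMap F F))) F
  have hinj : Function.Injective fun x : Res F F P => x ^ p := frobenius_inj (Res F F P) p
  exact ⟨hinj, Finite.surjective_of_injective hinj⟩

theorem resRing_perfect (p : ℕ) [Fact p.Prime] [CharP F p] [ExpChar (ResRing F F) p] :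
    PerfectRing (ResRing F F) p := by
  refine ⟨?_, ?_⟩
  · intro x y h
    obtain ⟨x, rfl⟩ := Ideal.Quotient.mk_surjective x
    obtain ⟨y, rfl⟩ := Ideal.Quotient.mk_surjective y
    have h' : famMk F F (x ^ p) = famMk F F (y ^ p) := by
      rw [map_pow, map_pow]; exact h
    rw [famMk_eq_iff] at h'
    refine famMk_eq_iff.2 (h'.subset fun P hP h => hP ?_)
    exact (res_frobenius p P).1 h
  · intro x
    obtain ⟨x, rfl⟩ := Ideal.Quotient.mk_surjective x
    choose y hy using fun P => (res_frobenius p P).2 (x P)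
    refine ⟨famMk F F y, (map_pow (famMk F F) y p).symm.trans ?_⟩
    exact congrArg (famMk F F) (funext hy)

variable (F) in
/-- `K^{1/p^∞} → ∏_P F[θ]/P / ⊕_P F[θ]/P`: the unique extension of reduction modulo almost
all `P`; if `x ^ (p ^ n) = y ∈ K`, it sends `x` to the `p ^ n`-th root of the class of `y`. -/
def iotaBase : Kperf F →+* ResRing F F :=
  haveI : Fact (ringChar F).Prime := ⟨CharP.char_is_prime F (ringChar F)⟩
  haveI : CharP (ResRing F F) (ringChar F) := resRing_charP _
  haveI : ExpChar (ResRing F F) (ringChar F) := ExpChar.prime Fact.out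
  haveI : PerfectRing (ResRing F F) (ringChar F) := resRing_perfect _
  haveI : CharP (RatFunc F) (ringChar F) :=
    charP_of_injective_algebraMap (algebraMap F (RatFunc F)).injective _
  haveI : ExpChar (RatFunc F) (ringChar F) := ExpChar.prime Fact.out
  haveI : ExpChar (Kperf F) (ringChar F) :=
    expChar_of_injective_algebraMap (algebraMap (RatFunc F) (Kperf F)).injective _
  PerfectRing.lift (algebraMap (RatFunc F) (Kperf F)) redK (ringChar F)


theorem iotaBase_algebraMap (r : RatFunc F) :
    iotaBase F (algebraMap (RatFunc F) (Kperf F) r) = redK r :=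
  haveI : Fact (ringChar F).Prime := ⟨CharP.char_is_prime F (ringChar F)⟩
  haveI : CharP (ResRing F F) (ringChar F) := resRing_charP _
  haveI : ExpChar (ResRing F F) (ringChar F) := ExpChar.prime Fact.out
  haveI : PerfectRing (ResRing F F) (ringChar F) := resRing_perfect _
  haveI : CharP (RatFunc F) (ringChar F) :=
    charP_of_injective_algebraMap (algebraMap F (RatFunc F)).injective _
  haveI : ExpChar (RatFunc F) (ringChar F) := ExpChar.prime Fact.out
  haveI : ExpChar (Kperf F) (ringChar F) :=
    expChar_of_injective_algebraMap (algebraMap (RatFunc F) (Kperf F)).injective _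
  PerfectRing.lift_comp_apply _ _ _ r

theorem iotaBase_toKperf (a : F[X]) : iotaBase F (toKperf F a) = diag F F a :=
  (iotaBase_algebraMap _).trans (IsLocalization.lift_eq _ a)

end Base

section Iota

variable (s : ℕ)

/-- `ι` on `K^{1/p^∞}[t_1, …, t_s]`: it is `iotaBase` on `K^{1/p^∞}` and the diagonal map on
`F[t_1, …, t_s]`. -/
def iotaPoly [Finite F] : MvPolynomial (Fin s) (Kperf F) →+* ResRing F (Fs F s) :=
  MvPolynomial.eval₂Hom ((resRingMap (Fs F s)).comp (iotaBase F))
    fun i => diag F (Fs F s) (C (algebraMap (MvPolynomial (Fin s) F) (Fs F s) (MvPolynomial.X i)))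

/-- The inclusion of `F[t_1, …, t_s][θ]` in `K^{1/p^∞}[t_1, …, t_s]`. -/
def inclPoly : (MvPolynomial (Fin s) F)[X] →+* MvPolynomial (Fin s) (Kperf F) :=
  eval₂RingHom (MvPolynomial.map ((toKperf F).comp C)) (MvPolynomial.C (toKperf F X))

variable {F s}

theorem inclPoly_map_C (b : F[X]) :
    inclPoly F s (b.map MvPolynomial.C) = MvPolynomial.C (toKperf F b) := by
  have : (inclPoly F s).comp (mapRingHom MvPolynomial.C) =
      (MvPolynomial.C).comp (toKperf F) := by
    ext x <;> simp [inclPoly]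
  exact congr($this b)

theorem iotaPoly_inclPoly [Finite F] (f : (MvPolynomial (Fin s) F)[X]) :
    iotaPoly F s (inclPoly F s f) = diag F (Fs F s) (f.map (algebraMap _ _)) := by
  have : (iotaPoly F s).comp (inclPoly F s) =
      (diag F (Fs F s)).comp (mapRingHom (algebraMap (MvPolynomial (Fin s) F) (Fs F s))) := by
    ext x
    · simp only [iotaPoly, inclPoly, RingHom.coe_comp, Function.comp_apply, coe_eval₂RingHom,
        eval₂_C, MvPolynomial.map_C, MvPolynomial.coe_eval₂Hom, MvPolynomial.eval₂_C,
        iotaBase_toKperf, resRingMap_diag, coe_mapRingHom, map_C]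
      rfl
    · simp [iotaPoly, inclPoly]
    · simp [iotaPoly, inclPoly, iotaBase_toKperf, resRingMap_diag]
  exact congr($this f)

theorem exists_pow_eq_inclPoly (p : ℕ) [Fact p.Prime] [CharP F p]
    (r : MvPolynomial (Fin s) (Kperf F)) :
    ∃ (n : ℕ) (a : F[X]) (f : (MvPolynomial (Fin s) F)[X]), a ≠ 0 ∧
      MvPolynomial.C (toKperf F a) * r ^ p ^ n = inclPoly F s f := by
  have : CharP (RatFunc F) p :=
    charP_of_injective_algebraMap (algebraMap F (RatFunc F)).injective _
  have : ExpChar (RatFunc F) p := ExpChar.prime Fact.out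
  have : ExpChar (Kperf F) p :=
    expChar_of_injective_algebraMap (algebraMap (RatFunc F) (Kperf F)).injective _
  induction r using MvPolynomial.induction_on with
  | C x =>
    obtain ⟨n, y, hy⟩ := IsPRadical.pow_mem (algebraMap (RatFunc F) (Kperf F)) p x
    obtain ⟨⟨b, a⟩, hab⟩ := IsLocalization.surj (nonZeroDivisors F[X]) y
    refine ⟨n, a, b.map MvPolynomial.C, nonZeroDivisors.ne_zero a.2, ?_⟩
    rw [inclPoly_map_C, ← map_pow, ← map_mul, ← hy]
    simp only [toKperf, RingHom.coe_comp, Function.comp_apply]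
    rw [← map_mul, mul_comm, hab]
  | add u v hu hv =>
    obtain ⟨n, a, f, ha, hf⟩ := hu
    obtain ⟨k, b, g, hb, hg⟩ := hv
    refine ⟨n + k, a ^ p ^ k * b ^ p ^ n, (b ^ p ^ n).map MvPolynomial.C * f ^ p ^ k +
      (a ^ p ^ k).map MvPolynomial.C * g ^ p ^ n, mul_ne_zero (pow_ne_zero _ ha)
      (pow_ne_zero _ hb), ?_⟩
    rw [map_add, map_mul, map_mul, map_mul, map_mul, inclPoly_map_C, inclPoly_map_C, map_pow (inclPoly F s),
      map_pow (inclPoly F s), ← hf, ← hg, add_pow_expChar_pow]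
    simp only [map_pow, mul_pow, ← pow_mul, pow_add]
    ring
  | mul_X u i hu =>
    obtain ⟨n, a, f, ha, hf⟩ := hu
    refine ⟨n, a, f * C (MvPolynomial.X i) ^ p ^ n, ha, ?_⟩
    rw [map_mul, ← hf, map_pow, mul_pow, mul_assoc]
    simp [inclPoly]

theorem iotaPoly_isUnit [Finite F] {r : MvPolynomial (Fin s) (Kperf F)} (hr : r ≠ 0) :
    IsUnit (iotaPoly F s r) := by
  have : Fact (ringChar F).Prime := ⟨CharP.char_is_prime F (ringChar F)⟩
  obtain ⟨n, a, f, ha, hf⟩ := exists_pow_eq_inclPoly (ringChar F) r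
  have ha' : toKperf F a ≠ 0 := by
    rw [toKperf, RingHom.comp_apply, ne_eq, map_eq_zero]
    simpa using ha
  have hf0 : f ≠ 0 := by
    rintro rfl
    rw [map_zero] at hf
    exact mul_ne_zero (MvPolynomial.C_ne_zero.2 ha') (pow_ne_zero _ hr) hf
  have hu := diag_isUnit (F := F) (E := Fs F s)
    ((Polynomial.map_ne_zero_iff (IsFractionRing.injective _ _)).2 hf0)
  rw [← iotaPoly_inclPoly, ← hf, map_mul, map_pow] at hu
  have hu' := isUnit_of_mul_isUnit_right hu
  exact (isUnit_pow_iff (pow_ne_zero _ (Fact.out : (ringChar F).Prime).ne_zero)).1 hu'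

variable (F s) in
/-- The embedding `ι : K^{1/p^∞}(t_1, …, t_s) → ∏_P F_s[θ]/P / ⊕_P F_s[θ]/P`. -/
def iota [Finite F] : PerfFrac F s →+* ResRing F (Fs F s) :=
  IsLocalization.lift (M := nonZeroDivisors (MvPolynomial (Fin s) (Kperf F)))
    (g := iotaPoly F s) fun y => iotaPoly_isUnit (nonZeroDivisors.ne_zero y.2)

end Iota

/-! ### Twisted power sums, their reductions, and finite zeta values -/

section Zeta

/-- The variable `t_i` as an element of `F_s`. -/
def tVar {s : ℕ} (i : Fin s) : Fs F s := algebraMap (MvPolynomial (Fin s) F) _ (MvPolynomial.X i)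

theorem aeval_tVar_ne_zero {s : ℕ} (i : Fin s) (P : Primes F) : aeval (tVar F i) P.1 ≠ 0 := by
  have h1 : Transcendental F (MvPolynomial.X i : MvPolynomial (Fin s) F) :=
    MvPolynomial.transcendental_X F i
  have h2 : Transcendental F (tVar F i) :=
    (transcendental_algebraMap_iff (IsFractionRing.injective _ _)).2 h1
  exact fun h => P.2.2.ne_zero ((transcendental_iff.1 h2) _ h)

variable [Fintype F]

open scoped Classical in
/-- `A^+(d)`: the monic polynomials of degree `d`. -/
def Aplus (d : ℕ) : Finset F[X] :=
  Finset.univ.image fun c : Fin d → F => X ^ d + ∑ i : Fin d, C (c i) * X ^ (i : ℕ)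

theorem mem_Aplus {d : ℕ} {a : F[X]} : a ∈ Aplus F d ↔ a.Monic ∧ a.natDegree = d := by
  have hlt : ∀ c : Fin d → F,
      (∑ i : Fin d, C (c i) * X ^ (i : ℕ) : F[X]).degree < (d : WithBot ℕ) := fun c => by
    refine lt_of_le_of_lt (degree_sum_le _ _)
      ((Finset.sup_lt_iff (WithBot.bot_lt_coe d)).2 fun i _ => ?_)
    exact lt_of_le_of_lt (degree_C_mul_X_pow_le _ _) (Nat.cast_lt.2 i.2)
  simp only [Aplus, Finset.mem_image, Finset.mem_univ, true_and]
  constructor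
  · rintro ⟨c, rfl⟩
    refine ⟨monic_X_pow_add (hlt c), ?_⟩
    refine natDegree_eq_of_degree_eq_some ?_
    rw [degree_add_eq_left_of_degree_lt (by simpa using hlt c), degree_X_pow]
  · rintro ⟨hm, rfl⟩
    refine ⟨fun i => a.coeff i, ?_⟩
    conv_rhs => rw [hm.as_sum]
    rw [Finset.sum_range]

/-- The integer `m = ⌊(s - 1) / (q - 1)⌋`. -/
def mOf (s : ℕ) : ℕ := (s - 1) / (Fintype.card F - 1)

/-- `S_d(n; s) = ∑_{a ∈ A^+(d)} a(t_1) ⋯ a(t_s) / a ^ n` in `K[t_1, …, t_s]`. -/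
def powerSum (d : ℕ) (n : ℤ) (s : ℕ) : MvPolynomial (Fin s) (RatFunc F) :=
  ∑ a ∈ Aplus F d, MvPolynomial.C ((algebraMap F[X] (RatFunc F) a ^ n)⁻¹) *
    ∏ j : Fin s, aeval (MvPolynomial.X j : MvPolynomial (Fin s) (RatFunc F)) a

/-- `F_d(n; s) = ∑_{i < d} S_i(n; s)`. -/
def harmonicSum (d : ℕ) (n : ℤ) (s : ℕ) : MvPolynomial (Fin s) (RatFunc F) :=
  ∑ i ∈ Finset.range d, powerSum F i n s

/-- `l_d = (θ - θ ^ q) ⋯ (θ - θ ^ (q ^ d))`. -/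
def lCarlitz (d : ℕ) : RatFunc F :=
  ∏ i ∈ Finset.Icc 1 d, (RatFunc.X - RatFunc.X ^ Fintype.card F ^ i)

/-- `b_d(t_j) = (t_j - θ) ⋯ (t_j - θ ^ (q ^ (d - 1)))`. -/
def bCarlitz {s : ℕ} (d : ℕ) (j : Fin s) : MvPolynomial (Fin s) (RatFunc F) :=
  ∏ i ∈ Finset.range d, (MvPolynomial.X j - MvPolynomial.C (RatFunc.X ^ Fintype.card F ^ i))

/-- `Π_{s,d} = b_{d-m}(t_1) ⋯ b_{d-m}(t_s) / l_{d-1}`, for `d ≥ max 1 m`. -/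
def piFactor (s d : ℕ) : MvPolynomial (Fin s) (RatFunc F) :=
  MvPolynomial.C (lCarlitz F (d - 1))⁻¹ * ∏ j : Fin s, bCarlitz F (d - mOf F s) j

variable {F} in
/-- Reduction modulo `P` of an element of `K` with denominator prime to `P`. -/
def redCoeff (E : Type*) [Field E] [Algebra F E] (P : Primes F) (c : RatFunc F) : Res F E P :=
  resMk P (c.num.map (algebraMap F E)) * Ring.inverse (resMk P (c.denom.map (algebraMap F E)))

variable {F} in
/-- Reduction modulo `P`, in `F_s[θ]/P`, of an element of `K[t_1, …, t_s]` whose coefficients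
have denominators prime to `P`. -/
def redPoly {s : ℕ} (P : Primes F) (f : MvPolynomial (Fin s) (RatFunc F)) : Res F (Fs F s) P :=
  ∑ e ∈ f.support, redCoeff (Fs F s) P (f.coeff e) *
    resMk P (C (algebraMap (MvPolynomial (Fin s) F) (Fs F s) (MvPolynomial.monomial e 1)))

/-- The finite zeta value of level `s` and exponent `n`: the class of the family
`F_{deg P}(n; s) mod P`. -/
def finiteZeta (n : ℤ) (s : ℕ) : ResRing F (Fs F s) :=
  famMk F (Fs F s) fun P => redPoly P (harmonicSum F P.1.natDegree n s)

/-! ### The units `π̂` and `ω̂(t_i)` -/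

theorem resMk_derivative_isUnit (E : Type*) [Field E] [Algebra F E] (P : Primes F) :
    IsUnit (resMk P ((derivative P.1).map (algebraMap F E)) : Res F E P) := by
  have h : IsCoprime P.1 (derivative P.1) := PerfectField.separable_of_irreducible P.2.2
  exact resMk_isUnit (h.symm.map (mapRingHom (algebraMap F E)))

/-- `π̂ = (-1 / P')_P`. -/
def hatPi (E : Type*) [Field E] [Algebra F E] : (ResRing F E)ˣ where
  val := famMk F E fun P => -Ring.inverse (resMk P ((derivative P.1).map (algebraMap F E)))
  inv := famMk F E fun P => -resMk P ((derivative P.1).map (algebraMap F E))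
  val_inv := by
    rw [← map_mul, ← map_one (famMk F E)]
    refine congrArg _ (funext fun P => ?_)
    simpa using Ring.inverse_mul_cancel _ (resMk_derivative_isUnit F E P)
  inv_val := by
    rw [← map_mul, ← map_one (famMk F E)]
    refine congrArg _ (funext fun P => ?_)
    simpa using Ring.mul_inverse_cancel _ (resMk_derivative_isUnit F E P)

/-- `ω̂(t_i) = (1 / P(t_i))_P`. -/
def hatOmega {s : ℕ} (i : Fin s) : (ResRing F (Fs F s))ˣ where
  val := famMk F (Fs F s) fun P => resMk P (C (aeval (tVar F i) P.1)⁻¹)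
  inv := famMk F (Fs F s) fun P => resMk P (C (aeval (tVar F i) P.1))
  val_inv := by
    rw [← map_mul, ← map_one (famMk F (Fs F s))]
    refine congrArg _ (funext fun P => ?_)
    rw [Pi.mul_apply, ← map_mul, ← C_mul, inv_mul_cancel₀ (aeval_tVar_ne_zero F i P)]
    simp
  inv_val := by
    rw [← map_mul, ← map_one (famMk F (Fs F s))]
    refine congrArg _ (funext fun P => ?_)
    rw [Pi.mul_apply, ← map_mul, ← C_mul, mul_inv_cancel₀ (aeval_tVar_ne_zero F i P)]
    simp

/-! ### The interpolating fraction `H_s` and the element `μ_{1,s}` -/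

/-- The field `K(Y, t_1, …, t_s)`, as the fraction field of `A[t_1, …, t_s][Y]`. -/
abbrev RatYT (s : ℕ) : Type _ := FractionRing (MvPolynomial (Fin s) F[X])[X]

variable {F} in
/-- Evaluation of a polynomial of `A[t_1, …, t_s][Y]` at `Y = y`, where `y` is in a field `S`
that receives `A` through `φ`. -/
def evalY {s : ℕ} {S : Type*} [Field S] (φ : F[X] →+* S) (y : S) :
    (MvPolynomial (Fin s) F[X])[X] →+* MvPolynomial (Fin s) S :=
  eval₂RingHom (MvPolynomial.map φ) (MvPolynomial.C y)

variable {F} in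
/-- The rational fraction `H ∈ K(Y, t_1, …, t_s)` is defined at `Y = y`, with value
`v ∈ S(t_1, …, t_s)`: it can be written as `N / D` where `D` does not vanish identically at
`Y = y`, and `v = N(y) / D(y)`. -/
def HasValue {s : ℕ} {S : Type*} [Field S] (φ : F[X] →+* S) (y : S) (H : RatYT F s)
    (v : FractionRing (MvPolynomial (Fin s) S)) : Prop :=
  ∃ N D : (MvPolynomial (Fin s) F[X])[X], evalY φ y D ≠ 0 ∧
    H = algebraMap _ _ N / algebraMap _ _ D ∧
    v = algebraMap _ _ (evalY φ y N) / algebraMap _ _ (evalY φ y D)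

variable {F} in
/-- `F_d(1; s) = Π_{s,d} · H|_{Y = θ ^ (q ^ (d - m))}` for all `d ≥ m`, `d ≥ 1`. -/
def Interpolates {s : ℕ} (H : RatYT F s) : Prop :=
  ∀ d : ℕ, 1 ≤ d → mOf F s ≤ d →
    ∃ v : FractionRing (MvPolynomial (Fin s) (RatFunc F)),
      HasValue (algebraMap F[X] (RatFunc F)) (RatFunc.X ^ Fintype.card F ^ (d - mOf F s)) H v ∧
      algebraMap _ _ (harmonicSum F d 1 s) = algebraMap _ _ (piFactor F s d) * v

theorem exists_root (j : ℕ) (x : Kperf F) : ∃ y : Kperf F, y ^ Fintype.card F ^ j = x := by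
  have : Fact (ringChar F).Prime := ⟨CharP.char_is_prime F (ringChar F)⟩
  have : CharP (AlgebraicClosure (RatFunc F)) (ringChar F) :=
    charP_of_injective_algebraMap (algebraMap F (AlgebraicClosure (RatFunc F))).injective _
  have : ExpChar (AlgebraicClosure (RatFunc F)) (ringChar F) := ExpChar.prime Fact.out
  have : PerfectRing (AlgebraicClosure (RatFunc F)) (ringChar F) := PerfectField.toPerfectRing _
  have : ExpChar (Kperf F) (ringChar F) :=
    expChar_of_injective_algebraMap (algebraMap F (Kperf F)).injective _
  obtain ⟨k, -, hk⟩ := FiniteField.card F (ringChar F)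
  obtain ⟨y, hy⟩ := (bijective_iterateFrobenius (Kperf F) (ringChar F) (k * j)).2 x
  exact ⟨y, by rw [hk, ← pow_mul, ← hy, iterateFrobenius_def]⟩

/-- `θ ^ (q ^ (-j))`: the `q ^ j`-th root of `θ` in `K^{1/p^∞}`; it is unique because
`x ↦ x ^ q` is injective. -/
def thetaRoot (j : ℕ) : Kperf F := (exists_root F j (toKperf F X)).choose

theorem thetaRoot_pow (j : ℕ) : thetaRoot F j ^ Fintype.card F ^ j = toKperf F X :=
  (exists_root F j (toKperf F X)).choose_spec

/-- `∏_{i=1}^s ∏_{j=1}^m (t_i - θ ^ (q ^ (-j)))` in `K^{1/p^∞}(t_1, …, t_s)`. -/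
def muDenom (s : ℕ) : PerfFrac F s :=
  algebraMap (MvPolynomial (Fin s) (Kperf F)) _ (∏ i : Fin s, ∏ j ∈ Finset.Icc 1 (mOf F s),
    (MvPolynomial.X i - MvPolynomial.C (thetaRoot F j)))

end Zeta

end FinZeta

end

/-!
Everything rests on the fact that, on polynomials `a` of degree `< d`, the values
`a(θ ^ (q ^ j)) = a(θ) ^ (q ^ j)` for `j < d` determine `a(t)` by Lagrange interpolation
(`aeval_polyOf_eq_sum`). Since `s ≡ 1 mod q - 1`, the sum `F_d(1; s)` is minus the sum of
`a(t_1) ⋯ a(t_s) / a` over all `a ≠ 0` of degree `< d`, and interpolation turns it into a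
combination, with Lagrange basis polynomials in the `t_i` as coefficients, of the power sums of
the `a(θ) ^ (q ^ (j_1) + ⋯ + q ^ (j_s) - 1)`. A power sum whose exponent is positive and a sum of
fewer than `d (q - 1)` powers of `q` vanishes (`shiftedPowerSum_add_one`). For `s = 1` only the
exponent `0` is left and `ℍ_1 = 1 / (t_1 - θ)`. For `s > 1`, so `m > 0`, only the exponents with
all `j_i ≥ n = d - m` survive, which produces the factor `b_n(t_1) ⋯ b_n(t_s)`
(`sum_prod_aeval_div_eq_shift`).

Put `Y = θ ^ (q ^ n)`. The surviving power sums have exponents `q ^ n N - 1`, with `N` a sum of `s`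
powers `q ^ k`, `k < m`. Interpolation at `t = Y ^ (q ^ m)` gives a recursion for them
(`shiftedPowerSum_mul_add_pow`) whose coefficients, after division by a power of `b_n(Y)` and by
`l_{d-1}`, are rational in `θ` and `Y` alone: this is because
`b_n(Y ^ (q ^ i)) = b_n(Y) ^ (q ^ i) γ_i(θ, Y)` with an explicit rational function `γ_i`
(`bProd_pow`). Solving the recursion over the field of rational fractions gives `ℍ_s`
(`exists_hasValue_normalizedPowerSum`, `exists_interpolates`); it is unique because it is
prescribed at infinitely many values of `Y` (`HasValue.eq_of_infinite`). At
`Y = θ ^ (q ^ (-m))` the factor `γ_m` vanishes, so the recursion leaves only its initial term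
`N = q ^ m`. The exponents `k` with `∑ q ^ (k_i) = q ^ m` exist, and products of Lagrange basis
polynomials in independent variables are linearly independent, so the value of `ℍ_s` there is
non-zero.

For the finite zeta value, let `d = deg P`. Modulo `P` one has `P(t) = b_d(t)` and `P' = l_{d-1}`,
because the roots of `P` are the `θ ^ (q ^ i)` with `i < d` (`resMk_C_aeval`,
`resMk_derivative`), and `θ ^ (q ^ (d - j))` is the `q ^ j`-th root of `θ`
(`iotaBase_thetaRoot`). So the reductions of `ℍ_s` at `Y = θ ^ (q ^ (d - m))` are the components of
the image under `ι` of its value at `θ ^ (q ^ (-m))` (`iotaPoly_evalY`), and reducing the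
interpolation formula modulo all `P` gives the theorem (`finiteZeta_eq`).
-/

noncomputable section

namespace FinZeta

/-! ### Sums of few powers of `q` -/

/-- `M` is a sum of at most `r` powers `q ^ k` with exponents `k ≤ B`, repetitions allowed. -/
def IsPowSum (q B r M : ℕ) : Prop :=
  ∃ u : Multiset ℕ, (∀ k ∈ u, k ≤ B) ∧ u.card ≤ r ∧ (u.map (q ^ ·)).sum = M

namespace IsPowSum

variable {q B B' r r' M M' : ℕ}

theorem mono (h : IsPowSum q B r M) (hB : B ≤ B') (hr : r ≤ r') : IsPowSum q B' r' M := by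
  obtain ⟨u, h1, h2, h3⟩ := h
  exact ⟨u, fun k hk => (h1 k hk).trans hB, h2.trans hr, h3⟩

theorem add (h : IsPowSum q B r M) (h' : IsPowSum q B r' M') :
    IsPowSum q B (r + r') (M + M') := by
  obtain ⟨u, h1, h2, h3⟩ := h
  obtain ⟨v, h1', h2', h3'⟩ := h'
  refine ⟨u + v, fun k hk => ?_, ?_, by simp [h3, h3']⟩
  · rcases Multiset.mem_add.1 hk with hk | hk
    exacts [h1 k hk, h1' k hk]
  · rw [Multiset.card_add]; omega

theorem pow_mul (h : IsPowSum q B r M) (n : ℕ) : IsPowSum q (B + n) r (q ^ n * M) := by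
  obtain ⟨u, h1, h2, h3⟩ := h
  refine ⟨u.map (· + n), ?_, by simpa using h2, ?_⟩
  · intro k hk
    obtain ⟨j, hj, rfl⟩ := Multiset.mem_map.1 hk
    exact Nat.add_le_add_right (h1 j hj) n
  · rw [Multiset.map_map, ← h3, ← Multiset.sum_map_mul_left]
    refine congrArg _ (Multiset.map_congr rfl fun k _ => ?_)
    simp only [Function.comp_apply]
    ring

theorem replicate (c : ℕ) {k : ℕ} (hk : k ≤ B) : IsPowSum q B c (c * q ^ k) :=
  ⟨Multiset.replicate c k, fun j hj => (Multiset.eq_of_mem_replicate hj).trans_le hk,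
    by simp, by simp⟩

theorem sum_pow {ι : Type*} (t : Finset ι) (k : ι → ℕ) (hk : ∀ i ∈ t, k i ≤ B) :
    IsPowSum q B t.card (∑ i ∈ t, q ^ k i) := by
  refine ⟨t.val.map k, ?_, by simp, by rw [Multiset.map_map]; rfl⟩
  intro j hj
  obtain ⟨i, hi, rfl⟩ := Multiset.mem_map.1 hj
  exact hk i hi

/-- The base `q` expansion of `M < q ^ d`. -/
theorem of_lt (hq : 1 < q) {d : ℕ} (h : M < q ^ d) : IsPowSum q d (d * (q - 1)) M := by
  induction d generalizing M with
  | zero =>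
    obtain rfl : M = 0 := by simpa using h
    exact ⟨0, by simp, by simp, by simp⟩
  | succ d ih =>
    have hc : M / q ^ d < q := Nat.div_lt_of_lt_mul (by rwa [pow_succ] at h)
    have h1 := (ih (Nat.mod_lt M (pow_pos (zero_lt_one.trans hq) d))).mono d.le_succ le_rfl
    have h2 := (replicate (q := q) (B := d + 1) (M / q ^ d) d.le_succ).add h1
    rw [mul_comm (M / q ^ d), Nat.div_add_mod] at h2
    refine h2.mono le_rfl ?_
    rw [add_mul, one_mul]
    omega

/-- Only `q ^ d - 1` has all of its `d` digits equal to `q - 1`. -/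
theorem of_lt_sub_one (hq : 1 < q) {d : ℕ} (h : M + 1 < q ^ d) :
    IsPowSum q d (d * (q - 1) - 1) M := by
  induction d generalizing M with
  | zero => simp at h
  | succ d ih =>
    have hc : M / q ^ d < q :=
      Nat.div_lt_of_lt_mul (by rw [pow_succ] at h; omega)
    have hR := Nat.mod_lt M (pow_pos (zero_lt_one.trans hq) d)
    have hM := Nat.div_add_mod M (q ^ d)
    have hd : 1 ≤ q ^ d := Nat.one_le_pow _ _ (zero_lt_one.trans hq)
    rcases (show M / q ^ d < q - 1 ∨ M / q ^ d = q - 1 by omega) with hlt | heq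
    · have h1 := (of_lt hq hR).mono d.le_succ le_rfl
      have h2 := (replicate (q := q) (B := d + 1) (M / q ^ d) d.le_succ).add h1
      rw [mul_comm (M / q ^ d), hM] at h2
      refine h2.mono le_rfl ?_
      rw [add_mul, one_mul]
      omega
    · have hR' : M % q ^ d + 1 < q ^ d := by
        rw [heq, Nat.mul_sub, mul_one] at hM
        rw [pow_succ] at h
        have := Nat.mul_le_mul_left (q ^ d) hq.le
        omega
      have h1 := (ih hR').mono d.le_succ le_rfl
      have h2 := (replicate (q := q) (B := d + 1) (M / q ^ d) d.le_succ).add h1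
      rw [mul_comm (M / q ^ d), hM] at h2
      refine h2.mono le_rfl ?_
      have : 1 ≤ d * (q - 1) := by
        rcases Nat.eq_zero_or_pos d with rfl | h0
        · simp at hR'
        · exact Nat.mul_pos h0 (by omega)
      rw [add_mul, one_mul]
      omega

/-- Splitting off the largest allowed power: carries in base `q` only decrease the number of
summands, so a representation with the fewest summands of a number `≥ q ^ B` contains `q ^ B`. -/
theorem sub_pow (hq : 1 < q) (h : IsPowSum q B r M) (hM : q ^ B ≤ M) :
    IsPowSum q B (r - 1) (M - q ^ B) := by
  obtain ⟨u, h1, h2, h3⟩ := h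
  induction hn : u.card using Nat.strong_induction_on generalizing u with
  | _ n ih =>
  by_cases hB : B ∈ u
  · obtain ⟨v, rfl⟩ := Multiset.exists_cons_of_mem hB
    refine ⟨v, fun k hk => h1 k (Multiset.mem_cons_of_mem hk), ?_, ?_⟩
    · rw [Multiset.card_cons] at h2; omega
    · rw [Multiset.map_cons, Multiset.sum_cons] at h3; omega
  have hlt : ∀ k ∈ u, k < B := fun k hk =>
    lt_of_le_of_ne (h1 k hk) fun hkB => hB (hkB ▸ hk)
  -- carry: replace `q` copies of `q ^ k` by one `q ^ (k + 1)`
  by_cases hc : ∃ k ∈ u, q ≤ u.count k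
  · obtain ⟨k, hk, hkq⟩ := hc
    obtain ⟨v, rfl⟩ := Multiset.le_iff_exists_add.1 (Multiset.le_count_iff_replicate_le.1 hkq)
    rw [Multiset.card_add, Multiset.card_replicate] at h2 hn
    refine ih (v.card + 1) (by omega) ((k + 1) ::ₘ v) ?_ ?_ ?_ (by simp)
    · intro j hj
      rcases Multiset.mem_cons.1 hj with rfl | hj
      · exact hlt _ hk
      · exact h1 j (Multiset.mem_add.2 (Or.inr hj))
    · rw [Multiset.card_cons]; omega
    · rw [← h3]
      simp [pow_succ, mul_comm]
  · -- with all multiplicities `< q` and all exponents `< B` the sum is at most `q ^ B - 1`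
    push Not at hc
    exfalso
    have hsum : (u.map (q ^ ·)).sum ≤ ∑ k ∈ Finset.range B, (q - 1) * q ^ k := by
      rw [Finset.sum_multiset_map_count]
      refine (Finset.sum_le_sum fun k hk => ?_).trans (Finset.sum_le_sum_of_subset
        (fun k hk => Finset.mem_range.2 (hlt k (Multiset.mem_toFinset.1 hk))))
      have := hc k (Multiset.mem_toFinset.1 hk)
      rw [smul_eq_mul]
      exact Nat.mul_le_mul_right _ (by omega)
    rw [← Finset.mul_sum, mul_comm, Nat.geomSum_eq hq, h3,
      Nat.div_mul_cancel (by simpa using Nat.sub_dvd_pow_sub_pow q 1 B)] at hsum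
    have : 1 ≤ q ^ B := Nat.one_le_pow _ _ (zero_lt_one.trans hq)
    omega

end IsPowSum

/-! ### Vanishing of power sums over polynomials of bounded degree -/

section PowerSums

theorem pow_multiset_sum {M ι : Type*} [CommMonoid M] (x : M) (u : Multiset ι) (f : ι → ℕ) :
    x ^ (u.map f).sum = (u.map fun i => x ^ f i).prod := by
  induction u using Multiset.induction with
  | empty => simp
  | cons i u ih => simp [pow_add, ih]

variable {F : Type*} [Field F]

/-- A polynomial of degree `< σ (q - 1)` in `σ` variables has sum zero over the points with
coordinates in `F`, also when its coefficients lie in an extension of `F`. -/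
theorem sum_eval_algebraMap_eq_zero [Fintype F] {L σ : Type*} [CommRing L] [Algebra F L] [Fintype σ]
    [DecidableEq σ] (f : MvPolynomial σ L)
    (hf : f.totalDegree < (Fintype.card F - 1) * Fintype.card σ) :
    ∑ x : σ → F, MvPolynomial.eval (fun i => algebraMap F L (x i)) f = 0 := by
  simp_rw [MvPolynomial.eval_eq]
  rw [Finset.sum_comm]
  refine Finset.sum_eq_zero fun e he => ?_
  rw [← Finset.mul_sum]
  have h := MvPolynomial.sum_eval_eq_zero (MvPolynomial.monomial e (1 : F)) (by
    rw [MvPolynomial.totalDegree_monomial _ one_ne_zero]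
    exact (MvPolynomial.le_totalDegree he).trans_lt hf)
  have h' := congrArg (algebraMap F L) h
  rw [map_sum, map_zero] at h'
  convert mul_zero _
  rw [← h']
  refine Finset.sum_congr rfl fun x _ => ?_
  rw [MvPolynomial.eval_monomial, one_mul, Finsupp.prod, map_prod]
  simp_rw [map_pow]

/-- The polynomial `c_0 + c_1 X + ⋯ + c_{d-1} X ^ (d-1)`. -/
def polyOf {d : ℕ} (c : Fin d → F) : F[X] := ∑ i : Fin d, C (c i) * X ^ (i : ℕ)

theorem degree_polyOf_lt {d : ℕ} (c : Fin d → F) : (polyOf c).degree < (d : WithBot ℕ) := by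
  refine lt_of_le_of_lt (degree_sum_le _ _)
    ((Finset.sup_lt_iff (WithBot.bot_lt_coe d)).2 fun i _ => ?_)
  exact lt_of_le_of_lt (degree_C_mul_X_pow_le _ _) (Nat.cast_lt.2 i.2)

theorem polyOf_eq_zero {d : ℕ} {c : Fin d → F} : polyOf c = 0 ↔ c = 0 := by
  refine ⟨fun h => funext fun i => ?_, fun h => by simp [polyOf, h]⟩
  have := congrArg (coeff · (i : ℕ)) h
  simpa [polyOf, coeff_X_pow, Fin.val_inj] using this

theorem polyOf_injective {d : ℕ} : Function.Injective (polyOf : (Fin d → F) → F[X]) := by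
  intro c c' h
  rw [← sub_eq_zero, ← polyOf_eq_zero, ← sub_eq_zero.2 h]
  simp [polyOf, sub_mul]

theorem aeval_polyOf_ne_zero {L : Type*} [Field L] [Algebra F L] {θ : L}
    (hθ : Transcendental F θ) {d : ℕ} {c : Fin d → F} (hc : c ≠ 0) :
    aeval θ (polyOf c) ≠ 0 := fun h =>
  hc (polyOf_eq_zero.1 ((transcendental_iff.1 hθ) _ h))

variable [Fintype F]

theorem aeval_pow_card {L : Type*} [CommRing L] [Algebra F L] (x : L) (f : F[X]) (k : ℕ) :
    aeval x f ^ Fintype.card F ^ k = aeval (x ^ Fintype.card F ^ k) f := by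
  induction k with
  | zero => simp
  | succ k ih =>
    rw [pow_succ, pow_mul, pow_mul, ih]
    exact (aeval_algHom_apply (FiniteField.frobeniusAlgHom F L) _ f).symm

variable {L : Type*} [Field L] [Algebra F L] {θ : L}

/-- The sum of the `a(θ) ^ (N - 1)` over the non-zero polynomials `a` of degree `< d`. The exponent
is shifted so that `N` is a sum of powers of `q` in the applications. The summand is written as
`a(θ) ^ N / a(θ)`; for `a = 0` it is `0 / 0 = 0`. -/
def shiftedPowerSum (F : Type*) [Field F] [Fintype F] {L : Type*} [Field L] [Algebra F L]
    (θ : L) (d N : ℕ) : L :=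
  ∑ c : Fin d → F, aeval θ (polyOf c) ^ N / aeval θ (polyOf c)

theorem shiftedPowerSum_one (hθ : Transcendental F θ) {d : ℕ} (hd : d ≠ 0) :
    shiftedPowerSum F θ d 1 = -1 := by
  classical
  have h : ∀ c : Fin d → F, aeval θ (polyOf c) ^ 1 / aeval θ (polyOf c) =
      (1 : L) - if c = 0 then 1 else 0 := by
    intro c
    split_ifs with hc
    · simp [hc, polyOf]
    · rw [pow_one, div_self (aeval_polyOf_ne_zero hθ hc), sub_zero]
  have hq : (Fintype.card F : L) = 0 := by
    rw [← map_natCast (algebraMap F L), FiniteField.cast_card_eq_zero, map_zero]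
  rw [shiftedPowerSum, Finset.sum_congr rfl fun c _ => h c, Finset.sum_sub_distrib]
  simp [hq, hd]

/-- A product of `r` linear forms on `F ^ d` has vanishing sum when `r < d (q - 1)`, and
`a(θ) ^ (q ^ k) = a(θ ^ (q ^ k))` is linear in the coefficients of `a`. -/
theorem shiftedPowerSum_add_one (hθ : Transcendental F θ) {d B r M : ℕ}
    (hM : IsPowSum (Fintype.card F) B r M) (hM0 : M ≠ 0) (hr : r < d * (Fintype.card F - 1)) :
    shiftedPowerSum F θ d (M + 1) = 0 := by
  classical
  obtain ⟨u, -, hu, rfl⟩ := hM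
  let f : MvPolynomial (Fin d) L := (u.map fun k =>
    ∑ i : Fin d, MvPolynomial.C ((θ ^ Fintype.card F ^ k) ^ (i : ℕ)) * MvPolynomial.X i).prod
  have hf : f.totalDegree ≤ u.card := by
    refine (MvPolynomial.totalDegree_multiset_prod _).trans ?_
    rw [Multiset.map_map]
    refine (Multiset.sum_le_card_nsmul _ 1 ?_).trans (by simp)
    intro x hx
    obtain ⟨k, -, rfl⟩ := Multiset.mem_map.1 hx
    refine MvPolynomial.totalDegree_finsetSum_le fun i _ => ?_
    refine (MvPolynomial.totalDegree_mul _ _).trans ?_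
    rw [MvPolynomial.totalDegree_C, MvPolynomial.totalDegree_X]
  have h0 := sum_eval_algebraMap_eq_zero (F := F) f (by
    rw [Fintype.card_fin, mul_comm]; omega)
  rw [← h0]
  refine Finset.sum_congr rfl fun c _ => ?_
  have hval : MvPolynomial.eval (fun i => algebraMap F L (c i)) f =
      aeval θ (polyOf c) ^ (u.map (Fintype.card F ^ ·)).sum := by
    rw [map_multiset_prod, Multiset.map_map, pow_multiset_sum]
    refine congrArg _ (Multiset.map_congr rfl fun k _ => ?_)
    rw [aeval_pow_card]
    simp only [Function.comp_apply, polyOf, map_sum, map_mul, map_pow, aeval_C, aeval_X,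
      MvPolynomial.eval_C, MvPolynomial.eval_X]
    exact Finset.sum_congr rfl fun i _ => mul_comm _ _
  rw [hval]
  by_cases hc : c = 0
  · have : aeval θ (polyOf c) = 0 := by simp [hc, polyOf]
    rw [this, zero_pow hM0]
    simp
  · rw [pow_succ, mul_div_cancel_right₀ _ (aeval_polyOf_ne_zero hθ hc)]

end PowerSums

/-! ### Lagrange interpolation at the points `θ ^ (q ^ j)` -/

section Interpolation

variable {L : Type*} [Field L]

/-- The Lagrange basis polynomial at the node `Y ^ (q ^ k)`, for the nodes `Y ^ (q ^ j)` with
`j < m`, evaluated at `t`. -/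
def lagrangeBasis (q m : ℕ) (Y t : L) (k : ℕ) : L :=
  ∏ j ∈ (Finset.range m).erase k, (t - Y ^ q ^ j) / (Y ^ q ^ k - Y ^ q ^ j)

/-- `b_n(t) = (t - θ) (t - θ ^ q) ⋯ (t - θ ^ (q ^ (n - 1)))`. -/
def bProd (q n : ℕ) (θ t : L) : L := ∏ i ∈ Finset.range n, (t - θ ^ q ^ i)

/-- `l_n = (θ - θ ^ q) ⋯ (θ - θ ^ (q ^ n))`. -/
def lProd (q n : ℕ) (θ : L) : L := ∏ i ∈ Finset.Icc 1 n, (θ - θ ^ q ^ i)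

theorem lagrangeBasis_eq_prod_ite (q m : ℕ) (Y t : L) (k : ℕ) :
    lagrangeBasis q m Y t k = ∏ j ∈ Finset.range m,
      if j ≠ k then (t - Y ^ q ^ j) / (Y ^ q ^ k - Y ^ q ^ j) else 1 := by
  rw [lagrangeBasis, ← Finset.filter_ne', Finset.prod_filter]

/-- Splitting off the first `n` of the nodes `θ ^ (q ^ j)`, `j < n + m`; the others are the nodes
`Y ^ (q ^ k)`, `k < m`, for `Y = θ ^ (q ^ n)`. -/
theorem lagrangeBasis_add (q n m : ℕ) (θ t : L) (k : ℕ) :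
    lagrangeBasis q (n + m) θ t (n + k) =
      bProd q n θ t / bProd q n θ ((θ ^ q ^ n) ^ q ^ k) *
        lagrangeBasis q m (θ ^ q ^ n) t k := by
  rw [lagrangeBasis_eq_prod_ite, lagrangeBasis_eq_prod_ite, Finset.prod_range_add, bProd, bProd,
    ← Finset.prod_div_distrib]
  congr 1
  · refine Finset.prod_congr rfl fun j hj => ?_
    rw [if_pos (by rw [Finset.mem_range] at hj; omega), pow_add, pow_mul]
  · refine Finset.prod_congr rfl fun j _ => ?_
    simp only [ne_eq, Nat.add_left_cancel_iff, pow_add, pow_mul]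

theorem lagrangeBasis_zero (q : ℕ) {d : ℕ} (hd : d ≠ 0) {θ t : L} (ht : t ≠ θ) :
    lagrangeBasis q d θ t 0 = (lProd q (d - 1) θ)⁻¹ * (bProd q d θ t / (t - θ)) := by
  obtain ⟨d, rfl⟩ := Nat.exists_eq_succ_of_ne_zero hd
  have ht' : t - θ ≠ 0 := sub_ne_zero.2 ht
  have hIcc : ∏ i ∈ Finset.Icc 1 d, (θ - θ ^ q ^ i) =
      ∏ i ∈ Finset.range d, (θ - θ ^ q ^ (i + 1)) := by
    rw [Finset.range_eq_Ico, Finset.prod_Ico_add' (fun i => θ - θ ^ q ^ i) 0 d 1]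
    rfl
  rw [lagrangeBasis_eq_prod_ite, Finset.prod_range_succ', bProd, Finset.prod_range_succ', lProd,
    Nat.succ_sub_one, hIcc]
  simp [mul_div_cancel_right₀ _ ht', div_eq_inv_mul, Finset.prod_mul_distrib]

end Interpolation

section Recursion

variable {F : Type*} [Field F] {L : Type*} [Field L] [Algebra F L] {θ : L}

theorem pow_injective_of_transcendental (hθ : Transcendental F θ) :
    Function.Injective fun a : ℕ => θ ^ a := by
  intro a b h
  by_contra hab
  have h0 := (transcendental_iff.1 hθ) (X ^ a - X ^ b) (by simpa [sub_eq_zero] using h)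
  have := congrArg (coeff · a) h0
  simp [coeff_X_pow, hab] at this

variable [Fintype F]

/-- The value of a polynomial of degree `< d` at any `t` in terms of its value at `θ`: the nodes
`θ ^ (q ^ j)` with `j < d` are distinct and the values there are powers of the value at `θ`. -/
theorem aeval_polyOf_eq_sum (hθ : Transcendental F θ) {d : ℕ} (c : Fin d → F) (t : L) :
    aeval t (polyOf c) = ∑ j ∈ Finset.range d, lagrangeBasis (Fintype.card F) d θ t j *
      aeval θ (polyOf c) ^ Fintype.card F ^ j := by
  have hinj : Set.InjOn (fun j : ℕ => θ ^ Fintype.card F ^ j) (Finset.range d) := by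
    intro i _ j _ h
    exact Nat.pow_right_injective Fintype.one_lt_card (pow_injective_of_transcendental hθ h)
  have h := Lagrange.eq_interpolate (f := (polyOf c).map (algebraMap F L)) hinj (by
    rw [degree_map, Finset.card_range]
    exact degree_polyOf_lt c)
  have h' := congrArg (eval t) h
  rw [eval_map_algebraMap] at h'
  rw [h', Lagrange.interpolate_apply, eval_finsetSum]
  refine Finset.sum_congr rfl fun j _ => ?_
  rw [eval_mul, eval_C, eval_map_algebraMap, ← aeval_pow_card, mul_comm, lagrangeBasis,
    Lagrange.basis, eval_prod]
  congr 1
  refine Finset.prod_congr rfl fun i _ => ?_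
  rw [Lagrange.basisDivisor, eval_mul, eval_C, eval_sub, eval_X, eval_C, div_eq_inv_mul]

/-- Interpolation at `t = θ ^ (q ^ d)` gives a recursion for the power sums. -/
theorem shiftedPowerSum_add_pow (hθ : Transcendental F θ) (d N : ℕ) :
    shiftedPowerSum F θ d (N + Fintype.card F ^ d) = ∑ j ∈ Finset.range d,
      lagrangeBasis (Fintype.card F) d θ (θ ^ Fintype.card F ^ d) j *
        shiftedPowerSum F θ d (N + Fintype.card F ^ j) := by
  simp_rw [shiftedPowerSum, Finset.mul_sum]
  rw [Finset.sum_comm]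
  refine Finset.sum_congr rfl fun c _ => ?_
  rw [pow_add, aeval_pow_card, aeval_polyOf_eq_sum hθ c (θ ^ _), Finset.mul_sum, Finset.sum_div]
  refine Finset.sum_congr rfl fun j _ => ?_
  rw [pow_add]
  ring

theorem shiftedPowerSum_pow_eq_zero (hθ : Transcendental F θ) {d j : ℕ} (hj0 : j ≠ 0)
    (hj : j < d) : shiftedPowerSum F θ d (Fintype.card F ^ j) = 0 := by
  have hq : 1 < Fintype.card F := Fintype.one_lt_card
  have h1 : 1 < Fintype.card F ^ j := Nat.one_lt_pow hj0 hq
  have h2 : Fintype.card F ^ j = Fintype.card F ^ j - 1 + 1 := by omega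
  rw [h2, shiftedPowerSum_add_one hθ
    (IsPowSum.of_lt hq (d := j) (M := Fintype.card F ^ j - 1) (by omega)) (by omega)]
  exact Nat.mul_lt_mul_of_pos_right hj (by omega)

theorem shiftedPowerSum_pow (hθ : Transcendental F θ) {d : ℕ} (hd : d ≠ 0) :
    shiftedPowerSum F θ d (Fintype.card F ^ d) =
      -lagrangeBasis (Fintype.card F) d θ (θ ^ Fintype.card F ^ d) 0 := by
  have h := shiftedPowerSum_add_pow hθ d 0
  rw [zero_add] at h
  rw [h, Finset.sum_eq_single_of_mem 0 (by simpa using Nat.pos_of_ne_zero hd)]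
  · simp [shiftedPowerSum_one hθ hd]
  · intro j hj hj0
    rw [Finset.mem_range] at hj
    rw [zero_add, shiftedPowerSum_pow_eq_zero hθ hj0 hj, mul_zero]

/-- In the recursion for the power sums of exponents divisible by `q ^ n`, the coefficients with
`j < n` meet power sums that vanish. -/
theorem shiftedPowerSum_mul_add_pow (hθ : Transcendental F θ) (n : ℕ) {m M : ℕ}
    (hM0 : M ≠ 0) (hM : IsPowSum (Fintype.card F) m (m * (Fintype.card F - 1)) M) :
    shiftedPowerSum F θ (n + m) (Fintype.card F ^ n * (M + Fintype.card F ^ m)) =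
      ∑ k ∈ Finset.range m,
        lagrangeBasis (Fintype.card F) (n + m) θ (θ ^ Fintype.card F ^ (n + m)) (n + k) *
          shiftedPowerSum F θ (n + m) (Fintype.card F ^ n * (M + Fintype.card F ^ k)) := by
  have hq : 1 < Fintype.card F := Fintype.one_lt_card
  rw [mul_add, ← pow_add, shiftedPowerSum_add_pow hθ, Finset.sum_range_add]
  simp_rw [mul_add, ← pow_add]
  rw [add_eq_right]
  refine Finset.sum_eq_zero fun j hj => ?_
  rw [Finset.mem_range] at hj
  have h1 : 1 ≤ Fintype.card F ^ j := Nat.one_le_pow j _ (by omega)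
  have h2 := ((hM.pow_mul n).mono (Nat.le_add_right _ j) le_rfl).add
    ((IsPowSum.of_lt hq (d := j) (M := Fintype.card F ^ j - 1) (by omega)).mono
      (Nat.le_add_left _ _) le_rfl)
  have h3 : Fintype.card F ^ n * M + Fintype.card F ^ j =
      Fintype.card F ^ n * M + (Fintype.card F ^ j - 1) + 1 := by omega
  have h4 : Fintype.card F ^ n * M ≠ 0 := mul_ne_zero (pow_ne_zero _ (by omega)) hM0
  rw [h3, shiftedPowerSum_add_one hθ h2 (by omega), mul_zero]
  rw [← add_mul]
  exact Nat.mul_lt_mul_of_pos_right (by omega) (by omega)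

/-- The bound `2 ≤ N` excludes the exponent `q ^ n N - 1 = 0`, for `n = 0`. -/
theorem shiftedPowerSum_mul_eq_zero (hθ : Transcendental F θ) (n : ℕ) {m N : ℕ}
    (hN : 2 ≤ N) (hNm : N < Fintype.card F ^ m) :
    shiftedPowerSum F θ (n + m) (Fintype.card F ^ n * N) = 0 := by
  have hq : 1 < Fintype.card F := Fintype.one_lt_card
  have h1 : 1 ≤ Fintype.card F ^ n := Nat.one_le_pow n _ (by omega)
  have h2 : Fintype.card F ^ n * N < Fintype.card F ^ (n + m) := by
    rw [pow_add]; exact Nat.mul_lt_mul_of_pos_left hNm (by omega)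
  have h3 : 2 ≤ Fintype.card F ^ n * N := by nlinarith
  have hm : m ≠ 0 := by rintro rfl; simp at hNm; omega
  rw [← Nat.sub_add_cancel (show 1 ≤ Fintype.card F ^ n * N by omega),
    shiftedPowerSum_add_one hθ (IsPowSum.of_lt_sub_one hq (d := n + m) (by omega)) (by omega)]
  have : 0 < (n + m) * (Fintype.card F - 1) := Nat.mul_pos (by omega) (by omega)
  omega

theorem sum_prod_aeval_div_eq (hθ : Transcendental F θ) (d : ℕ) {s : ℕ} (t : Fin s → L) :
    ∑ c : Fin d → F, (∏ i, aeval (t i) (polyOf c)) / aeval θ (polyOf c) =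
      ∑ k ∈ Fintype.piFinset fun _ : Fin s => Finset.range d,
        (∏ i, lagrangeBasis (Fintype.card F) d θ (t i) (k i)) *
          shiftedPowerSum F θ d (∑ i, Fintype.card F ^ k i) := by
  simp_rw [shiftedPowerSum, Finset.mul_sum]
  rw [Finset.sum_comm]
  refine Finset.sum_congr rfl fun c _ => ?_
  simp_rw [aeval_polyOf_eq_sum hθ c (t _)]
  rw [Finset.prod_univ_sum, Finset.sum_div]
  refine Finset.sum_congr rfl fun k _ => ?_
  rw [Finset.prod_mul_distrib, Finset.prod_pow_eq_pow_sum, mul_div_assoc]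

/-- Only the nodes `θ ^ (q ^ (n + k))` contribute: the sum is divisible by the product of the
`b_n(t_i)`. -/
theorem sum_prod_aeval_div_eq_shift (hθ : Transcendental F θ) (n : ℕ) {m : ℕ} (hm : m ≠ 0)
    (t : Fin (m * (Fintype.card F - 1) + 1) → L) :
    ∑ c : Fin (n + m) → F, (∏ i, aeval (t i) (polyOf c)) / aeval θ (polyOf c) =
      ∑ k ∈ Fintype.piFinset fun _ => Finset.range m,
        (∏ i, lagrangeBasis (Fintype.card F) (n + m) θ (t i) (n + k i)) *
          shiftedPowerSum F θ (n + m) (Fintype.card F ^ n * ∑ i, Fintype.card F ^ k i) := by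
  have hq : 1 < Fintype.card F := Fintype.one_lt_card
  rw [sum_prod_aeval_div_eq hθ]
  symm
  refine Finset.sum_of_injOn (fun k i => n + k i) ?_ ?_ ?_ ?_
  · intro k _ k' _ h
    funext i
    exact Nat.add_left_cancel (congrFun h i)
  · intro k hk
    simp only [Finset.mem_coe, Fintype.mem_piFinset, Finset.mem_range] at hk ⊢
    intro i
    have := hk i
    omega
  · intro k hk hk'
    simp only [Fintype.mem_piFinset, Finset.mem_range] at hk
    have hex : ∃ i, k i < n := by
      by_contra! hn
      refine hk' ⟨fun i => k i - n, ?_, ?_⟩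
      · simp only [Finset.mem_coe, Fintype.mem_piFinset, Finset.mem_range]
        intro i
        have := hk i
        have := hn i
        omega
      · funext i
        have := hn i
        simp only
        omega
    obtain ⟨i, hi⟩ := hex
    have h1 : 1 ≤ Fintype.card F ^ k i := Nat.one_le_pow _ _ (by omega)
    have h2 := (IsPowSum.sum_pow (q := Fintype.card F) (B := n + m) (Finset.univ.erase i) k
      fun j _ => (hk j).le).add ((IsPowSum.of_lt hq (d := k i)
        (M := Fintype.card F ^ k i - 1) (by omega)).mono (hk i).le le_rfl)
    rw [Finset.card_erase_of_mem (Finset.mem_univ i), Finset.card_univ, Fintype.card_fin,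
      Nat.add_sub_cancel] at h2
    have h3 := Finset.sum_erase_add Finset.univ (fun j => Fintype.card F ^ k j)
      (Finset.mem_univ i)
    have h4 : ∑ j, Fintype.card F ^ k j = ∑ j ∈ Finset.univ.erase i, Fintype.card F ^ k j +
        (Fintype.card F ^ k i - 1) + 1 := by omega
    -- a node with `k_i < n` leaves an exponent that is a sum of at most
    -- `m (q - 1) + k_i (q - 1) < (n + m) (q - 1)` powers of `q`
    rw [h4, shiftedPowerSum_add_one hθ h2, mul_zero]
    · have hcard : (Finset.univ.erase i).card = m * (Fintype.card F - 1) := by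
        rw [Finset.card_erase_of_mem (Finset.mem_univ i), Finset.card_univ, Fintype.card_fin,
          Nat.add_sub_cancel]
      have : 0 < m * (Fintype.card F - 1) := Nat.mul_pos (by omega) (by omega)
      have hle : ∑ j ∈ Finset.univ.erase i, 1 ≤
          ∑ j ∈ Finset.univ.erase i, Fintype.card F ^ k j :=
        Finset.sum_le_sum fun j _ => Nat.one_le_pow _ _ (by omega)
      rw [Finset.sum_const, hcard] at hle
      simp only [smul_eq_mul, mul_one] at hle
      omega
    · rw [← add_mul]
      exact Nat.mul_lt_mul_of_pos_right (by omega) (by omega)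
  · intro k _
    congr 2
    rw [Finset.mul_sum]
    exact Finset.sum_congr rfl fun i _ => (pow_add _ _ _).symm

end Recursion

/-! ### Power sums as rational functions of `Y = θ ^ (q ^ n)` -/

section NormalizedPowerSum


/-- The rational function `γ_i` of `θ` and `Y` with `b_n(Y ^ (q ^ i)) = b_n(Y) ^ (q ^ i) γ_i`
for `Y = θ ^ (q ^ n)`. -/
def gammaFactor {L : Type*} [Field L] (q : ℕ) (θ Y : L) : ℕ → L
  | 0 => 1
  | i + 1 => gammaFactor q θ Y i ^ q * ((Y ^ q ^ (i + 1) - θ) / (Y ^ q ^ (i + 1) - Y))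

/-- The rational function of `θ` and `Y` that interpolates the normalised power sum with
`N = q ^ m`; the factor `Y ^ (q ^ m) - θ` of `γ_m` has been cancelled. -/
def baseValue {L : Type*} [Field L] (q m : ℕ) (θ Y : L) : L :=
  gammaFactor q θ Y (m - 1) ^ q / (Y ^ q ^ m - Y) *
    ∏ k ∈ Finset.range m, (Y ^ q ^ m - Y ^ q ^ k)

variable {F : Type*} [Field F] [Fintype F] {L : Type*} [Field L] [Algebra F L] {θ : L}

theorem pow_card_pow_ne (hθ : Transcendental F θ) {i j : ℕ} (h : i ≠ j) :
    θ ^ Fintype.card F ^ i ≠ θ ^ Fintype.card F ^ j := fun h' =>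
  h (Nat.pow_right_injective Fintype.one_lt_card (pow_injective_of_transcendental hθ h'))

theorem bProd_pow_ne_zero (hθ : Transcendental F θ) (n i : ℕ) :
    bProd (Fintype.card F) n θ ((θ ^ Fintype.card F ^ n) ^ Fintype.card F ^ i) ≠ 0 := by
  refine Finset.prod_ne_zero_iff.2 fun j hj => sub_ne_zero.2 ?_
  rw [Finset.mem_range] at hj
  rw [← pow_mul, ← pow_add]
  exact pow_card_pow_ne hθ (by omega)

theorem lProd_ne_zero (hθ : Transcendental F θ) (n : ℕ) : lProd (Fintype.card F) n θ ≠ 0 := by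
  refine Finset.prod_ne_zero_iff.2 fun j hj => sub_ne_zero.2 fun h => ?_
  rw [Finset.mem_Icc] at hj
  exact pow_card_pow_ne hθ (i := 0) (j := j) (by omega) (by simpa using h)

/-- The key to rationality in `Y`: raising `b_n(Y ^ (q ^ i))` to the power `q` shifts the roots
`θ ^ (q ^ j)` by one, so only the first and the last factor change. -/
theorem bProd_pow (hθ : Transcendental F θ) (n i : ℕ) :
    bProd (Fintype.card F) n θ ((θ ^ Fintype.card F ^ n) ^ Fintype.card F ^ i) =
      bProd (Fintype.card F) n θ (θ ^ Fintype.card F ^ n) ^ Fintype.card F ^ i *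
        gammaFactor (Fintype.card F) θ (θ ^ Fintype.card F ^ n) i := by
  induction i with
  | zero => simp [gammaFactor]
  | succ i ih =>
    set q := Fintype.card F
    set Y := θ ^ q ^ n with hY
    have hne : Y ^ q ^ (i + 1) - Y ≠ 0 := by
      rw [sub_ne_zero, hY, ← pow_mul, ← pow_add]
      exact pow_card_pow_ne hθ (by omega)
    have hfrob : bProd q n θ (Y ^ q ^ i) ^ q =
        ∏ j ∈ Finset.range n, (Y ^ q ^ (i + 1) - θ ^ q ^ (j + 1)) := by
      rw [bProd, ← Finset.prod_pow]
      refine Finset.prod_congr rfl fun j _ => ?_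
      have := map_sub (FiniteField.frobeniusAlgHom F L) (Y ^ q ^ i) (θ ^ q ^ j)
      simp only [FiniteField.coe_frobeniusAlgHom] at this
      rw [this, pow_succ, pow_succ, pow_mul, pow_mul]
    have hshift : bProd q n θ (Y ^ q ^ (i + 1)) * (Y ^ q ^ (i + 1) - Y) =
        bProd q n θ (Y ^ q ^ i) ^ q * (Y ^ q ^ (i + 1) - θ) := by
      rw [hfrob, bProd, hY, ← Finset.prod_range_succ, Finset.prod_range_succ', pow_zero, pow_one]
    rw [gammaFactor, eq_div_of_mul_eq hne hshift, ih, mul_pow, ← pow_mul, ← pow_succ]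
    ring

theorem gammaFactor_ne_zero (hθ : Transcendental F θ) (n i : ℕ) :
    gammaFactor (Fintype.card F) θ (θ ^ Fintype.card F ^ n) i ≠ 0 := by
  intro h
  have := bProd_pow hθ n i
  rw [h, mul_zero] at this
  exact bProd_pow_ne_zero hθ n i this

/-- The sum of the `a(θ) ^ (q ^ n N - 1)` over the non-zero `a` of degree `< n + m`, divided by
`-b_n(Y) ^ N / l_{n + m - 1}` where `Y = θ ^ (q ^ n)`. -/
def normalizedPowerSum (F : Type*) [Field F] [Fintype F] {L : Type*} [Field L] [Algebra F L]
    (θ : L) (m n N : ℕ) : L :=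
  -(lProd (Fintype.card F) (n + m - 1) θ *
    shiftedPowerSum F θ (n + m) (Fintype.card F ^ n * N) /
      bProd (Fintype.card F) n θ (θ ^ Fintype.card F ^ n) ^ N)

theorem bProd_self_ne_zero (hθ : Transcendental F θ) (n : ℕ) :
    bProd (Fintype.card F) n θ (θ ^ Fintype.card F ^ n) ≠ 0 := by
  simpa using bProd_pow_ne_zero hθ n 0

theorem shiftedPowerSum_eq_normalizedPowerSum (hθ : Transcendental F θ) (m n N : ℕ) :
    shiftedPowerSum F θ (n + m) (Fintype.card F ^ n * N) =
      -((lProd (Fintype.card F) (n + m - 1) θ)⁻¹ *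
        bProd (Fintype.card F) n θ (θ ^ Fintype.card F ^ n) ^ N *
          normalizedPowerSum F θ m n N) := by
  have h1 := lProd_ne_zero hθ (n + m - 1)
  have h2 := pow_ne_zero N (bProd_self_ne_zero hθ n)
  rw [normalizedPowerSum]
  field_simp

theorem normalizedPowerSum_of_lt (hθ : Transcendental F θ) (n : ℕ) {m N : ℕ} (hN : 2 ≤ N)
    (hNm : N < Fintype.card F ^ m) : normalizedPowerSum F θ m n N = 0 := by
  rw [normalizedPowerSum, shiftedPowerSum_mul_eq_zero hθ n hN hNm]
  simp

theorem normalizedPowerSum_pow (hθ : Transcendental F θ) (n : ℕ) {m : ℕ} (hm : m ≠ 0) :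
    normalizedPowerSum F θ m n (Fintype.card F ^ m) =
      baseValue (Fintype.card F) m θ (θ ^ Fintype.card F ^ n) := by
  have hx : θ ^ Fintype.card F ^ (n + m) ≠ θ := by
    simpa using pow_card_pow_ne hθ (i := n + m) (j := 0) (by omega)
  have h1 := lProd_ne_zero hθ (n + m - 1)
  have h2 := pow_ne_zero (Fintype.card F ^ m) (bProd_self_ne_zero hθ n)
  have h3 : bProd (Fintype.card F) (n + m) θ (θ ^ Fintype.card F ^ (n + m)) =
      bProd (Fintype.card F) n θ ((θ ^ Fintype.card F ^ n) ^ Fintype.card F ^ m) *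
        ∏ k ∈ Finset.range m, ((θ ^ Fintype.card F ^ n) ^ Fintype.card F ^ m -
          (θ ^ Fintype.card F ^ n) ^ Fintype.card F ^ k) := by
    simp_rw [← pow_mul, ← pow_add]
    rw [bProd, Finset.prod_range_add, bProd]
  obtain ⟨m, rfl⟩ := Nat.exists_eq_succ_of_ne_zero hm
  have hx' := sub_ne_zero.2 hx
  rw [normalizedPowerSum, ← pow_add, shiftedPowerSum_pow hθ (by omega),
    lagrangeBasis_zero _ (by omega) hx, h3, bProd_pow hθ, baseValue, gammaFactor,
    Nat.succ_eq_add_one, Nat.add_sub_cancel]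
  have hY : θ ^ Fintype.card F ^ (n + (m + 1)) =
      (θ ^ Fintype.card F ^ n) ^ Fintype.card F ^ (m + 1) := by rw [pow_add, pow_mul]
  rw [Nat.succ_eq_add_one, hY] at hx'
  rw [Nat.succ_eq_add_one] at h1 h2
  rw [hY]
  generalize bProd (Fintype.card F) n θ (θ ^ Fintype.card F ^ n) ^ Fintype.card F ^ (m + 1) = b
    at h2 ⊢
  generalize (θ ^ Fintype.card F ^ n) ^ Fintype.card F ^ (m + 1) = y at hx' ⊢
  field_simp

/-- The recursion for the normalised power sums has coefficients that are rational in `θ` and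
`Y = θ ^ (q ^ n)`. -/
theorem normalizedPowerSum_add_pow (hθ : Transcendental F θ) (n : ℕ) {m M : ℕ}
    (hM0 : M ≠ 0) (hM : IsPowSum (Fintype.card F) m (m * (Fintype.card F - 1)) M) :
    normalizedPowerSum F θ m n (M + Fintype.card F ^ m) =
      gammaFactor (Fintype.card F) θ (θ ^ Fintype.card F ^ n) m * ∑ k ∈ Finset.range m,
        lagrangeBasis (Fintype.card F) m (θ ^ Fintype.card F ^ n)
          ((θ ^ Fintype.card F ^ n) ^ Fintype.card F ^ m) k /
            gammaFactor (Fintype.card F) θ (θ ^ Fintype.card F ^ n) k *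
          normalizedPowerSum F θ m n (M + Fintype.card F ^ k) := by
  have h1 := lProd_ne_zero hθ (n + m - 1)
  have hb := bProd_self_ne_zero hθ n
  rw [normalizedPowerSum, shiftedPowerSum_mul_add_pow hθ n hM0 hM, Finset.mul_sum,
    Finset.sum_div, ← Finset.sum_neg_distrib, Finset.mul_sum]
  refine Finset.sum_congr rfl fun k _ => ?_
  have hg := gammaFactor_ne_zero hθ n k
  have hY : θ ^ Fintype.card F ^ (n + m) =
      (θ ^ Fintype.card F ^ n) ^ Fintype.card F ^ m := by rw [pow_add, pow_mul]
  rw [shiftedPowerSum_eq_normalizedPowerSum hθ, lagrangeBasis_add, hY, bProd_pow hθ,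
    bProd_pow hθ, pow_add, pow_add]
  have h2 := pow_ne_zero M hb
  have h3 := pow_ne_zero (Fintype.card F ^ k) hb
  have h4 := pow_ne_zero (Fintype.card F ^ m) hb
  field_simp

/-- The sum over the non-zero `a` of degree `< n + m` in terms of the normalised power sums. -/
theorem sum_prod_aeval_div_eq_normalized (hθ : Transcendental F θ) (n : ℕ) {m : ℕ} (hm : m ≠ 0)
    (t : Fin (m * (Fintype.card F - 1) + 1) → L) :
    -∑ c : Fin (n + m) → F, (∏ i, aeval (t i) (polyOf c)) / aeval θ (polyOf c) =
      (lProd (Fintype.card F) (n + m - 1) θ)⁻¹ * (∏ i, bProd (Fintype.card F) n θ (t i)) *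
        ∑ k ∈ Fintype.piFinset fun _ => Finset.range m,
          (∏ i, lagrangeBasis (Fintype.card F) m (θ ^ Fintype.card F ^ n) (t i) (k i) /
            gammaFactor (Fintype.card F) θ (θ ^ Fintype.card F ^ n) (k i)) *
          normalizedPowerSum F θ m n (∑ i, Fintype.card F ^ k i) := by
  have hb := bProd_self_ne_zero hθ n
  rw [sum_prod_aeval_div_eq_shift hθ n hm, ← Finset.sum_neg_distrib, Finset.mul_sum]
  refine Finset.sum_congr rfl fun k _ => ?_
  simp_rw [lagrangeBasis_add, bProd_pow hθ]
  rw [shiftedPowerSum_eq_normalizedPowerSum hθ, ← Finset.prod_pow_eq_pow_sum]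
  simp_rw [Finset.prod_mul_distrib, Finset.prod_div_distrib, Finset.prod_mul_distrib]
  have h1 : ∏ i, gammaFactor (Fintype.card F) θ (θ ^ Fintype.card F ^ n) (k i) ≠ 0 :=
    Finset.prod_ne_zero_iff.2 fun i _ => gammaFactor_ne_zero hθ n (k i)
  have h2 : ∏ i, bProd (Fintype.card F) n θ (θ ^ Fintype.card F ^ n) ^ Fintype.card F ^ k i ≠ 0 :=
    Finset.prod_ne_zero_iff.2 fun i _ => pow_ne_zero _ hb
  field_simp

end NormalizedPowerSum

/-! ### The sums `F_d(1; s)` over monic polynomials -/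

section HarmonicSum

variable {F : Type*} [Field F]

theorem polyOf_snoc {d : ℕ} (c : Fin d → F) (u : F) :
    polyOf (Fin.snoc c u : Fin (d + 1) → F) = C u * X ^ d + polyOf c := by
  rw [polyOf, Fin.sum_univ_castSucc, add_comm, polyOf]
  simp

theorem polyOf_smul {d : ℕ} (c : Fin d → F) (u : F) : polyOf (u • c) = C u * polyOf c := by
  simp [polyOf, Finset.mul_sum, mul_assoc]

/-- The inclusion of `S` in `S(t_1, …, t_s)`. -/
def constVal (S : Type*) [Field S] (s : ℕ) : S →+* FractionRing (MvPolynomial (Fin s) S) :=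
  (algebraMap (MvPolynomial (Fin s) S) _).comp MvPolynomial.C

/-- The variable `t_i` of `S(t_1, …, t_s)`. -/
def varVal (S : Type*) [Field S] {s : ℕ} (i : Fin s) : FractionRing (MvPolynomial (Fin s) S) :=
  algebraMap (MvPolynomial (Fin s) S) _ (MvPolynomial.X i)

theorem constVal_algebraMap (s : ℕ) (a : F[X]) :
    constVal (RatFunc F) s (algebraMap F[X] (RatFunc F) a) =
      aeval (constVal (RatFunc F) s RatFunc.X) a := by
  have : (constVal (RatFunc F) s).comp (algebraMap F[X] (RatFunc F)) =
      (aeval (constVal (RatFunc F) s RatFunc.X)).toRingHom := by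
    ext x
    · simp only [RingHom.comp_apply, AlgHom.toRingHom_eq_coe, RingHom.coe_coe, aeval_C]
      rw [IsScalarTower.algebraMap_apply F (MvPolynomial (Fin s) (RatFunc F)),
        IsScalarTower.algebraMap_apply F (RatFunc F) (MvPolynomial (Fin s) (RatFunc F)),
        IsScalarTower.algebraMap_apply F F[X] (RatFunc F)]
      rfl
    · simp
  exact congr($this a)

theorem transcendental_constVal_X (s : ℕ) :
    Transcendental F (constVal (RatFunc F) s RatFunc.X) := by
  rw [transcendental_iff]
  intro p hp
  rw [← constVal_algebraMap, map_eq_zero] at hp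
  simpa using hp

variable [Fintype F]

theorem sum_Aplus {M : Type*} [AddCommMonoid M] (f : F[X] → M) (d : ℕ) :
    ∑ a ∈ Aplus F d, f a = ∑ c : Fin d → F, f (X ^ d + polyOf c) := by
  classical
  rw [Aplus, Finset.sum_image]
  · rfl
  · intro c _ c' _ h
    exact polyOf_injective (add_left_cancel h)

/-- A function on polynomials that is invariant under scaling has `q - 1 = -1` times the same
sum over all polynomials as over the monic ones. -/
theorem sum_polyOf_eq_neg_sum_Aplus {L : Type*} [Field L] [Algebra F L] (f : F[X] → L)
    (h0 : f 0 = 0) (hf : ∀ (u : F) (a : F[X]), u ≠ 0 → f (C u * a) = f a) (d : ℕ) :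
    ∑ c : Fin d → F, f (polyOf c) = -∑ i ∈ Finset.range d, ∑ a ∈ Aplus F i, f a := by
  classical
  induction d with
  | zero => simp [polyOf, h0]
  | succ d ih =>
    have hu : ∀ u : F, u ≠ 0 →
        ∑ c : Fin d → F, f (C u * X ^ d + polyOf c) = ∑ a ∈ Aplus F d, f a := by
      intro u hu
      rw [sum_Aplus, ← Equiv.sum_comp (MulAction.toPerm (Units.mk0 u hu))]
      refine Finset.sum_congr rfl fun c _ => ?_
      rw [← hf u (X ^ d + _) hu, mul_add, ← polyOf_smul]
      rfl
    have hq : (Fintype.card F : L) = 0 := by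
      rw [← map_natCast (algebraMap F L), FiniteField.cast_card_eq_zero, map_zero]
    rw [← Equiv.sum_comp (Fin.snocEquiv fun _ : Fin (d + 1) => F), Fintype.sum_prod_type]
    simp only [Fin.snocEquiv, Equiv.coe_fn_mk, polyOf_snoc]
    rw [← Finset.add_sum_erase _ _ (Finset.mem_univ (0 : F)),
      Finset.sum_congr rfl fun u hu' => hu u (Finset.ne_of_mem_erase hu'), Finset.sum_const,
      Finset.card_erase_of_mem (Finset.mem_univ _), Finset.card_univ, nsmul_eq_mul,
      Nat.cast_sub Fintype.card_pos, hq, Finset.sum_range_succ]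
    simp only [map_zero, zero_mul, zero_add, ih, Nat.cast_one]
    ring

theorem algebraMap_harmonicSum {s : ℕ} (hs : s ≠ 0) (hmod : s ≡ 1 [MOD Fintype.card F - 1])
    (d : ℕ) :
    algebraMap _ (FractionRing (MvPolynomial (Fin s) (RatFunc F))) (harmonicSum F d 1 s) =
      -∑ c : Fin d → F, (∏ i, aeval (varVal (RatFunc F) i) (polyOf c)) /
        aeval (constVal (RatFunc F) s RatFunc.X) (polyOf c) := by
  rw [sum_polyOf_eq_neg_sum_Aplus (fun a : F[X] => (∏ i, aeval (varVal (RatFunc F) i) a) /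
    aeval (constVal (RatFunc F) s RatFunc.X) a), neg_neg, harmonicSum, map_sum]
  · refine Finset.sum_congr rfl fun i _ => ?_
    rw [powerSum, map_sum]
    refine Finset.sum_congr rfl fun a _ => ?_
    rw [map_mul, map_prod, zpow_one, ← constVal_algebraMap, div_eq_inv_mul]
    congr 1
    · exact map_inv₀ (constVal (RatFunc F) s) _
    · refine Finset.prod_congr rfl fun j _ => ?_
      rw [varVal, aeval_algebraMap_apply]
  · simp
  · intro u a hu
    have hu' : algebraMap F (FractionRing (MvPolynomial (Fin s) (RatFunc F))) u ≠ 0 := by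
      simpa using hu
    have hpow : u ^ s = u := by
      obtain ⟨s, rfl⟩ := Nat.exists_eq_succ_of_ne_zero hs
      obtain ⟨k, rfl⟩ : Fintype.card F - 1 ∣ s := by
        simpa using (Nat.modEq_iff_dvd' (by omega)).1 hmod.symm
      rw [Nat.succ_eq_add_one, pow_succ, pow_mul, FiniteField.pow_card_sub_one_eq_one u hu, one_pow,
        one_mul]
    simp only [map_mul, aeval_C, Finset.prod_mul_distrib, Finset.prod_const, Finset.card_univ,
      Fintype.card_fin]
    rw [← map_pow, hpow, mul_div_mul_left _ _ hu']

end HarmonicSum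

/-! ### Values of rational fractions in `Y` -/

section HasValue

variable {F : Type*} [Field F] {s : ℕ} {S : Type*} [Field S] {φ : F[X] →+* S} {y : S}

/-- The element `Y` of `K(Y, t_1, …, t_s)`. -/
def ratY (F : Type*) [Field F] (s : ℕ) : RatYT F s :=
  algebraMap (MvPolynomial (Fin s) F[X])[X] _ X

/-- The element `t_i` of `K(Y, t_1, …, t_s)`. -/
def ratT (F : Type*) [Field F] {s : ℕ} (i : Fin s) : RatYT F s :=
  algebraMap (MvPolynomial (Fin s) F[X])[X] _ (C (MvPolynomial.X i))

/-- The element `θ` of `K(Y, t_1, …, t_s)`. -/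
def ratTheta (F : Type*) [Field F] (s : ℕ) : RatYT F s :=
  algebraMap (MvPolynomial (Fin s) F[X])[X] _ (C (MvPolynomial.C X))

theorem algebraMap_evalY_ne_zero {D : (MvPolynomial (Fin s) F[X])[X]} (hD : evalY φ y D ≠ 0) :
    algebraMap _ (FractionRing (MvPolynomial (Fin s) S)) (evalY φ y D) ≠ 0 ∧
      algebraMap _ (RatYT F s) D ≠ 0 := by
  have h0 : D ≠ 0 := by rintro rfl; simp at hD
  exact ⟨(map_ne_zero_iff _ (IsFractionRing.injective _ _)).2 hD,
    (map_ne_zero_iff _ (IsFractionRing.injective _ _)).2 h0⟩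

namespace HasValue

variable {H H' : RatYT F s} {v v' : FractionRing (MvPolynomial (Fin s) S)}

theorem of_polynomial (N : (MvPolynomial (Fin s) F[X])[X]) :
    HasValue φ y (algebraMap _ (RatYT F s) N) (algebraMap _ _ (evalY φ y N)) :=
  ⟨N, 1, by simp, by simp, by simp⟩

theorem ratY : HasValue φ y (ratY F s) (constVal S s y) := by
  have := of_polynomial (φ := φ) (y := y) (X : (MvPolynomial (Fin s) F[X])[X])
  simpa [evalY, FinZeta.ratY, constVal] using this

theorem ratT (i : Fin s) : HasValue φ y (ratT F i) (varVal S i) := by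
  have := of_polynomial (φ := φ) (y := y) (C (MvPolynomial.X i) : (MvPolynomial (Fin s) F[X])[X])
  simpa [evalY, FinZeta.ratT, varVal] using this

theorem ratTheta : HasValue φ y (ratTheta F s) (constVal S s (φ X)) := by
  have := of_polynomial (φ := φ) (y := y) (C (MvPolynomial.C X) : (MvPolynomial (Fin s) F[X])[X])
  simpa [evalY, FinZeta.ratTheta, constVal] using this

theorem zero : HasValue φ y (0 : RatYT F s) 0 := by
  simpa using of_polynomial (φ := φ) (y := y) (0 : (MvPolynomial (Fin s) F[X])[X])

theorem one : HasValue φ y (1 : RatYT F s) 1 := by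
  simpa using of_polynomial (φ := φ) (y := y) (1 : (MvPolynomial (Fin s) F[X])[X])

theorem add (h : HasValue φ y H v) (h' : HasValue φ y H' v') :
    HasValue φ y (H + H') (v + v') := by
  obtain ⟨N, D, hD, rfl, rfl⟩ := h
  obtain ⟨N', D', hD', rfl, rfl⟩ := h'
  obtain ⟨h1, h2⟩ := algebraMap_evalY_ne_zero hD
  obtain ⟨h1', h2'⟩ := algebraMap_evalY_ne_zero hD'
  refine ⟨N * D' + D * N', D * D', by rw [map_mul]; exact mul_ne_zero hD hD', ?_, ?_⟩
  · rw [div_add_div _ _ h2 h2']; simp only [map_add, map_mul]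
  · rw [div_add_div _ _ h1 h1']; simp only [map_add, map_mul]

theorem mul (h : HasValue φ y H v) (h' : HasValue φ y H' v') :
    HasValue φ y (H * H') (v * v') := by
  obtain ⟨N, D, hD, rfl, rfl⟩ := h
  obtain ⟨N', D', hD', rfl, rfl⟩ := h'
  refine ⟨N * N', D * D', by rw [map_mul]; exact mul_ne_zero hD hD', ?_, ?_⟩
  · rw [div_mul_div_comm]; simp only [map_mul]
  · rw [div_mul_div_comm]; simp only [map_mul]

theorem neg (h : HasValue φ y H v) : HasValue φ y (-H) (-v) := by
  obtain ⟨N, D, hD, rfl, rfl⟩ := h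
  have h1 : algebraMap _ (RatYT F s) (-N) = -algebraMap _ _ N := map_neg (algebraMap _ _) N
  have h2 : evalY φ y (-N) = -evalY φ y N := map_neg (evalY φ y) N
  exact ⟨-N, D, hD, by rw [h1, neg_div], by rw [h2, RingHom.map_neg, neg_div]⟩

theorem sub (h : HasValue φ y H v) (h' : HasValue φ y H' v') :
    HasValue φ y (H - H') (v - v') := by
  rw [sub_eq_add_neg, sub_eq_add_neg]
  exact h.add h'.neg

theorem inv (h : HasValue φ y H v) (hv : v ≠ 0) : HasValue φ y H⁻¹ v⁻¹ := by
  obtain ⟨N, D, hD, rfl, rfl⟩ := h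
  refine ⟨D, N, ?_, inv_div _ _, inv_div _ _⟩
  intro h0
  simp [h0] at hv

theorem div (h : HasValue φ y H v) (h' : HasValue φ y H' v') (hv' : v' ≠ 0) :
    HasValue φ y (H / H') (v / v') := by
  rw [div_eq_mul_inv, div_eq_mul_inv]
  exact h.mul (h'.inv hv')

theorem pow (h : HasValue φ y H v) (n : ℕ) : HasValue φ y (H ^ n) (v ^ n) := by
  induction n with
  | zero => simpa using one
  | succ n ih => simpa only [pow_succ] using ih.mul h

theorem sum {ι : Type*} (u : Finset ι) {f : ι → RatYT F s}
    {g : ι → FractionRing (MvPolynomial (Fin s) S)} (h : ∀ i ∈ u, HasValue φ y (f i) (g i)) :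
    HasValue φ y (∑ i ∈ u, f i) (∑ i ∈ u, g i) := by
  classical
  induction u using Finset.induction_on with
  | empty => simpa using zero
  | insert i u hi ih =>
    rw [Finset.sum_insert hi, Finset.sum_insert hi]
    exact (h i (Finset.mem_insert_self i u)).add
      (ih fun j hj => h j (Finset.mem_insert_of_mem hj))

theorem prod {ι : Type*} (u : Finset ι) {f : ι → RatYT F s}
    {g : ι → FractionRing (MvPolynomial (Fin s) S)} (h : ∀ i ∈ u, HasValue φ y (f i) (g i)) :
    HasValue φ y (∏ i ∈ u, f i) (∏ i ∈ u, g i) := by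
  classical
  induction u using Finset.induction_on with
  | empty => simpa using one
  | insert i u hi ih =>
    rw [Finset.prod_insert hi, Finset.prod_insert hi]
    exact (h i (Finset.mem_insert_self i u)).mul
      (ih fun j hj => h j (Finset.mem_insert_of_mem hj))

/-- The value may be computed from any representation as a fraction, even one whose denominator
vanishes. -/
theorem mul_eq (h : HasValue φ y H v) {N D : (MvPolynomial (Fin s) F[X])[X]}
    (hH : H * algebraMap _ _ D = algebraMap _ _ N) :
    v * algebraMap _ _ (evalY φ y D) = algebraMap _ _ (evalY φ y N) := by
  obtain ⟨N', D', hD', rfl, rfl⟩ := h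
  obtain ⟨h1', h2'⟩ := algebraMap_evalY_ne_zero hD'
  rw [div_mul_eq_mul_div, div_eq_iff h2', ← map_mul, ← map_mul] at hH
  have := congrArg (evalY φ y) (IsFractionRing.injective _ (RatYT F s) hH)
  rw [div_mul_eq_mul_div, div_eq_iff h1', ← map_mul, ← map_mul, ← map_mul, ← map_mul, this]

/-- A rational fraction is determined by its values at infinitely many points of the field of
constants. -/
theorem eq_of_infinite {ι : Type*} [Infinite ι] (hφ : Function.Injective φ) {z : ι → S}
    (hz : Function.Injective z) {w : ι → FractionRing (MvPolynomial (Fin s) S)}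
    (h : ∀ n, HasValue φ (z n) H (w n)) (h' : ∀ n, HasValue φ (z n) H' (w n)) : H = H' := by
  obtain ⟨N, D, hD, hH⟩ := IsFractionRing.div_surjective (A := (MvPolynomial (Fin s) F[X])[X]) H
  obtain ⟨N', D', hD', hH'⟩ :=
    IsFractionRing.div_surjective (A := (MvPolynomial (Fin s) F[X])[X]) H'
  have h2 : algebraMap _ (RatYT F s) D ≠ 0 := (map_ne_zero_iff _ (IsFractionRing.injective _ _)).2
    (nonZeroDivisors.ne_zero hD)
  have h2' : algebraMap _ (RatYT F s) D' ≠ 0 := (map_ne_zero_iff _ (IsFractionRing.injective _ _)).2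
    (nonZeroDivisors.ne_zero hD')
  have key : ∀ n, evalY φ (z n) (N * D') = evalY φ (z n) (N' * D) := by
    intro n
    have e1 := (h n).mul_eq ((div_eq_iff h2).1 hH).symm
    have e2 := (h' n).mul_eq ((div_eq_iff h2').1 hH').symm
    apply IsFractionRing.injective _ (FractionRing (MvPolynomial (Fin s) S))
    rw [map_mul, map_mul, map_mul, map_mul, ← e1, ← e2]
    ring
  have h0 : (N * D').map (MvPolynomial.map φ) = (N' * D).map (MvPolynomial.map φ) := by
    refine Polynomial.eq_of_infinite_eval_eq _ _ ?_
    refine (Set.infinite_range_of_injective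
      ((MvPolynomial.C_injective (Fin s) S).comp hz)).mono ?_
    rintro _ ⟨n, rfl⟩
    have := key n
    rwa [evalY, coe_eval₂RingHom, eval₂_eq_eval_map, eval₂_eq_eval_map] at this
  have h1 : N * D' = N' * D := Polynomial.map_injective _ (MvPolynomial.map_injective φ hφ) h0
  rw [← hH, ← hH', div_eq_div_iff h2 h2', ← map_mul, ← map_mul, h1]

/-! ### Values of the coefficients of the recursion -/

variable {q : ℕ} {θ' Y' : FractionRing (MvPolynomial (Fin s) S)} {θ Y T : RatYT F s}
  {t' : FractionRing (MvPolynomial (Fin s) S)}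

theorem gammaFactor (hθ : HasValue φ y θ θ') (hY : HasValue φ y Y Y') {i : ℕ}
    (hi : ∀ j, 1 ≤ j → j ≤ i → Y' ^ q ^ j ≠ Y') :
    HasValue φ y (gammaFactor q θ Y i) (gammaFactor q θ' Y' i) := by
  induction i with
  | zero => exact one
  | succ i ih =>
    exact ((ih fun j h1 h2 => hi j h1 (by omega)).pow q).mul
      (((hY.pow _).sub hθ).div ((hY.pow _).sub hY) (sub_ne_zero.2 (hi _ (by omega) le_rfl)))

theorem baseValue (hθ : HasValue φ y θ θ') (hY : HasValue φ y Y Y') {m : ℕ} (hm : m ≠ 0)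
    (hi : ∀ j, 1 ≤ j → j ≤ m → Y' ^ q ^ j ≠ Y') :
    HasValue φ y (baseValue q m θ Y) (baseValue q m θ' Y') :=
  (((gammaFactor hθ hY fun j h1 h2 => hi j h1 (by omega)).pow q).div ((hY.pow _).sub hY)
    (sub_ne_zero.2 (hi m (by omega) le_rfl))).mul
      (prod _ fun k _ => (hY.pow _).sub (hY.pow _))

theorem lagrangeBasis (hY : HasValue φ y Y Y') (hT : HasValue φ y T t') {m k : ℕ}
    (hi : ∀ j < m, j ≠ k → Y' ^ q ^ k ≠ Y' ^ q ^ j) :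
    HasValue φ y (lagrangeBasis q m Y T k) (lagrangeBasis q m Y' t' k) := by
  refine prod _ fun j hj => (hT.sub (hY.pow _)).div ((hY.pow _).sub (hY.pow _)) ?_
  rw [Finset.mem_erase, Finset.mem_range] at hj
  exact sub_ne_zero.2 (hi j hj.2 hj.1)

end HasValue

end HasValue

/-! ### Rational fractions that interpolate the normalised power sums -/

section RationalPowerSum


section MapField

variable {L M : Type*} [Field L] [Field M] (f : L →+* M) (q m : ℕ) (θ Y : L)

theorem map_gammaFactor (i : ℕ) : f (gammaFactor q θ Y i) = gammaFactor q (f θ) (f Y) i := by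
  induction i with
  | zero => simp [gammaFactor]
  | succ i ih => simp [gammaFactor, ih]

theorem map_baseValue : f (baseValue q m θ Y) = baseValue q m (f θ) (f Y) := by
  simp [baseValue, map_gammaFactor]

variable {q m θ Y}

theorem lagrangeBasis_node (hY : ∀ i < m, ∀ j < m, Y ^ q ^ i = Y ^ q ^ j → i = j) {k l : ℕ}
    (hk : k < m) (hl : l < m) :
    lagrangeBasis q m Y (Y ^ q ^ l) k = if k = l then 1 else 0 := by
  split_ifs with h
  · subst h
    refine Finset.prod_eq_one fun j hj => div_self (sub_ne_zero.2 fun h => ?_)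
    rw [Finset.mem_erase, Finset.mem_range] at hj
    exact hj.1 (hY _ hk _ hj.2 h).symm
  · refine Finset.prod_eq_zero (i := l) ?_ (by simp)
    rw [Finset.mem_erase, Finset.mem_range]
    exact ⟨fun h' => h h'.symm, hl⟩

theorem gammaFactor_ne_zero_of_forall {i : ℕ} (h : ∀ j, 1 ≤ j → j ≤ i → Y ^ q ^ j ≠ Y)
    (h' : ∀ j, 1 ≤ j → j ≤ i → Y ^ q ^ j ≠ θ) : gammaFactor q θ Y i ≠ 0 := by
  induction i with
  | zero => exact one_ne_zero
  | succ i ih =>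
    exact mul_ne_zero (pow_ne_zero _ (ih (fun j h1 h2 => h j h1 (by omega))
      fun j h1 h2 => h' j h1 (by omega)))
      (div_ne_zero (sub_ne_zero.2 (h' _ (by omega) le_rfl))
        (sub_ne_zero.2 (h _ (by omega) le_rfl)))

/-- `q ^ m` is the sum of `q - 1` copies of each `q ^ k` with `k < m`, and `1`. -/
theorem sum_pow_div_add_one {q : ℕ} (hq : 1 < q) (m : ℕ) :
    ∑ i ∈ Finset.range (m * (q - 1)), q ^ (i / (q - 1)) + 1 = q ^ m := by
  induction m with
  | zero => simp
  | succ m ih =>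
    have h : ∀ x ∈ Finset.range (q - 1), q ^ ((m * (q - 1) + x) / (q - 1)) = q ^ m := by
      intro x hx
      rw [Finset.mem_range] at hx
      rw [mul_comm, Nat.mul_add_div (by omega), Nat.div_eq_of_lt hx, add_zero]
    rw [add_mul, one_mul, Finset.sum_range_add, Finset.sum_congr rfl h, Finset.sum_const,
      Finset.card_range, smul_eq_mul, add_right_comm, ih, pow_succ]
    obtain ⟨r, rfl⟩ := Nat.exists_eq_add_of_lt hq
    simp only [Nat.add_sub_cancel]
    ring_nf

end MapField

variable {F : Type*} [Field F]

theorem toKperf_injective : Function.Injective (toKperf F) :=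
  (algebraMap (RatFunc F) (Kperf F)).injective.comp (IsFractionRing.injective F[X] (RatFunc F))

variable [Fintype F]

theorem thetaRoot_pow_ne (m : ℕ) {i j : ℕ} (h : i ≠ j) :
    thetaRoot F m ^ Fintype.card F ^ i ≠ thetaRoot F m ^ Fintype.card F ^ j := by
  intro h'
  have h1 := congrArg (· ^ Fintype.card F ^ m) h'
  simp only [← pow_mul, mul_comm _ (Fintype.card F ^ m)] at h1
  rw [pow_mul, pow_mul, thetaRoot_pow, ← map_pow, ← map_pow] at h1
  have h2 := congrArg natDegree (toKperf_injective h1)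
  rw [natDegree_X_pow, natDegree_X_pow] at h2
  exact h (Nat.pow_right_injective Fintype.one_lt_card h2)

theorem constVal_X_pow_ne (s n : ℕ) {i j : ℕ} (h : i ≠ j) :
    (constVal (RatFunc F) s RatFunc.X ^ Fintype.card F ^ n) ^ Fintype.card F ^ i ≠
      (constVal (RatFunc F) s RatFunc.X ^ Fintype.card F ^ n) ^ Fintype.card F ^ j := by
  have hθ := transcendental_constVal_X (F := F) s
  rw [← pow_mul, ← pow_mul, ← pow_add, ← pow_add]
  exact pow_card_pow_ne hθ (by omega)

theorem constVal_thetaRoot_pow_ne (s m : ℕ) {i j : ℕ} (h : i ≠ j) :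
    constVal (Kperf F) s (thetaRoot F m) ^ Fintype.card F ^ i ≠
      constVal (Kperf F) s (thetaRoot F m) ^ Fintype.card F ^ j := by
  rw [← map_pow, ← map_pow]
  exact fun h' => thetaRoot_pow_ne m h ((constVal (Kperf F) s).injective h')

theorem constVal_thetaRoot_pow (s m : ℕ) :
    constVal (Kperf F) s (thetaRoot F m) ^ Fintype.card F ^ m =
      constVal (Kperf F) s (toKperf F X) := by
  rw [← map_pow, thetaRoot_pow]

theorem hasValue_ratY_pow (s n : ℕ) :
    HasValue (algebraMap F[X] (RatFunc F)) (RatFunc.X ^ Fintype.card F ^ n) (ratY F s)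
      (constVal (RatFunc F) s RatFunc.X ^ Fintype.card F ^ n) := by
  rw [← map_pow]
  exact HasValue.ratY

theorem hasValue_ratTheta_X (s n : ℕ) :
    HasValue (algebraMap F[X] (RatFunc F)) (RatFunc.X ^ Fintype.card F ^ n) (ratTheta F s)
      (constVal (RatFunc F) s RatFunc.X) := by
  simpa using HasValue.ratTheta (φ := algebraMap F[X] (RatFunc F)) (s := s)
    (y := RatFunc.X ^ Fintype.card F ^ n)

/-- The normalised power sums with `N` a sum of few powers of `q` are the values at
`Y = θ ^ (q ^ n)` of one rational fraction. At `Y = θ ^ (q ^ (-m))` the factor `γ_m` of the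
recursion vanishes, so that only the initial value of the recursion survives. -/
theorem exists_hasValue_normalizedPowerSum (s : ℕ) {m N : ℕ} (hm : m ≠ 0) (hN2 : 2 ≤ N)
    (hN : IsPowSum (Fintype.card F) m (m * (Fintype.card F - 1) + 1) N) :
    ∃ h : RatYT F s,
      (∀ n, HasValue (algebraMap F[X] (RatFunc F)) (RatFunc.X ^ Fintype.card F ^ n) h
        (normalizedPowerSum F (constVal (RatFunc F) s RatFunc.X) m n N)) ∧
      HasValue (toKperf F) (thetaRoot F m) h (if N = Fintype.card F ^ m then
        constVal (Kperf F) s (baseValue (Fintype.card F) m (toKperf F X) (thetaRoot F m))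
          else 0) := by
  have hq : 1 < Fintype.card F := Fintype.one_lt_card
  have hθ := transcendental_constVal_X (F := F) s
  set θ := constVal (RatFunc F) s RatFunc.X with hθ'
  set q := Fintype.card F with hq'
  have hY : ∀ n, HasValue (algebraMap F[X] (RatFunc F)) (RatFunc.X ^ q ^ n) (ratY F s)
      (θ ^ q ^ n) := hasValue_ratY_pow s
  have hΘ : ∀ n, HasValue (algebraMap F[X] (RatFunc F)) (RatFunc.X ^ q ^ n) (ratTheta F s) θ :=
    hasValue_ratTheta_X s
  have hne : ∀ n i j, i ≠ j → (θ ^ q ^ n) ^ q ^ i ≠ (θ ^ q ^ n) ^ q ^ j :=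
    fun n i j => constVal_X_pow_ne s n
  have hne' : ∀ n j, 1 ≤ j → (θ ^ q ^ n) ^ q ^ j ≠ θ ^ q ^ n := fun n j hj => by
    simpa using hne n j 0 (by omega)
  set y := constVal (Kperf F) s (thetaRoot F m) with hy
  have hYr : HasValue (toKperf F) (thetaRoot F m) (ratY F s) y := HasValue.ratY
  have hΘr : HasValue (toKperf F) (thetaRoot F m) (ratTheta F s)
      (constVal (Kperf F) s (toKperf F X)) := HasValue.ratTheta
  have hner : ∀ i j, i ≠ j → y ^ q ^ i ≠ y ^ q ^ j := fun i j => constVal_thetaRoot_pow_ne s m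
  have hner' : ∀ j, 1 ≤ j → y ^ q ^ j ≠ y := fun j hj => by
    simpa using hner j 0 (by omega)
  have hyθ : y ^ q ^ m = constVal (Kperf F) s (toKperf F X) := constVal_thetaRoot_pow s m
  induction N using Nat.strong_induction_on with
  | _ N ih =>
  rcases lt_trichotomy N (q ^ m) with hlt | rfl | hgt
  · refine ⟨0, fun n => ?_, ?_⟩
    · rw [normalizedPowerSum_of_lt hθ n hN2 hlt]
      exact HasValue.zero
    · rw [if_neg hlt.ne]
      exact HasValue.zero
  · refine ⟨baseValue q m (ratTheta F s) (ratY F s), fun n => ?_, ?_⟩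
    · rw [normalizedPowerSum_pow hθ n hm]
      exact HasValue.baseValue (hΘ n) (hY n) hm fun j hj _ => hne' n j hj
    · rw [if_pos rfl, map_baseValue]
      exact HasValue.baseValue hΘr hYr hm fun j hj _ => hner' j hj
  · obtain ⟨M, rfl⟩ := Nat.exists_eq_add_of_lt hgt
    -- `N = M' + q ^ m`, where `M'` is a sum of at most `m (q - 1)` powers of `q`
    obtain ⟨M', hM'⟩ : ∃ M', q ^ m + M + 1 = M' + q ^ m ∧ M' ≠ 0 := ⟨M + 1, by omega, by omega⟩
    obtain ⟨hM', hM0⟩ := hM'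
    rw [hM'] at hN hN2 ih ⊢
    have hM := hN.sub_pow hq (Nat.le_add_left _ _)
    rw [Nat.add_sub_cancel, Nat.add_sub_cancel] at hM
    have hk : ∀ k : ℕ, k < m → ∃ h : RatYT F s,
        (∀ n, HasValue (algebraMap F[X] (RatFunc F)) (RatFunc.X ^ q ^ n) h
          (normalizedPowerSum F θ m n (M' + q ^ k))) ∧
        ∃ v, HasValue (toKperf F) (thetaRoot F m) h v := by
      intro k hk
      have h1 : q ^ k < q ^ m := Nat.pow_lt_pow_right hq hk
      have h2 : 1 ≤ q ^ k := Nat.one_le_pow _ _ (by omega)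
      obtain ⟨h, h3, h4⟩ := ih (M' + q ^ k) (by omega) (by omega)
        (by simpa using hM.add (IsPowSum.replicate (q := q) 1 hk.le))
      exact ⟨h, h3, _, h4⟩
    choose! h h3 v h4 using hk
    refine ⟨gammaFactor q (ratTheta F s) (ratY F s) m * ∑ k ∈ Finset.range m,
      lagrangeBasis q m (ratY F s) (ratY F s ^ q ^ m) k /
        gammaFactor q (ratTheta F s) (ratY F s) k * h k, fun n => ?_, ?_⟩
    · rw [normalizedPowerSum_add_pow hθ n hM0 hM]
      refine (HasValue.gammaFactor (hΘ n) (hY n) fun j hj _ => hne' n j hj).mul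
        (HasValue.sum _ fun k hk => ?_)
      rw [Finset.mem_range] at hk
      exact ((HasValue.lagrangeBasis (hY n) ((hY n).pow _) fun j _ hj =>
        hne n k j hj.symm).div (HasValue.gammaFactor (hΘ n) (hY n) fun j hj _ => hne' n j hj)
          (gammaFactor_ne_zero hθ n k)).mul (h3 k hk n)
    · rw [if_neg (by omega)]
      -- `γ_m` has the factor `Y ^ (q ^ m) - θ`
      have hγ : gammaFactor q (constVal (Kperf F) s (toKperf F X)) y m = 0 := by
        obtain ⟨m, rfl⟩ := Nat.exists_eq_succ_of_ne_zero hm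
        rw [gammaFactor, ← hyθ, sub_self, zero_div, mul_zero]
      have h5 := (HasValue.gammaFactor (q := q) (i := m) hΘr hYr fun j hj _ => hner' j hj).mul
        (HasValue.sum (Finset.range m) fun k hk =>
          ((HasValue.lagrangeBasis (q := q) (m := m) (k := k) hYr (hYr.pow (q ^ m)) fun j _ hj =>
            hner k j hj.symm).div
            (HasValue.gammaFactor (i := k) hΘr hYr fun j hj _ => hner' j hj)
            (gammaFactor_ne_zero_of_forall (fun j hj _ => hner' j hj) fun j _ hj => by
              rw [← hyθ]
              rw [Finset.mem_range] at hk
              exact hner j m (by omega))).mul (h4 k (Finset.mem_range.1 hk)))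
      rwa [hγ, zero_mul] at h5

end RationalPowerSum

/-! ### Existence and uniqueness of the interpolating fraction -/

section Existence


variable {F : Type*} [Field F]

theorem algebraMap_C_eq_constVal (S : Type*) [Field S] (s : ℕ) (x : S) :
    algebraMap (MvPolynomial (Fin s) S) (FractionRing (MvPolynomial (Fin s) S))
      (MvPolynomial.C x) = constVal S s x := rfl

theorem algebraMap_X_eq_varVal (S : Type*) [Field S] {s : ℕ} (i : Fin s) :
    algebraMap (MvPolynomial (Fin s) S) (FractionRing (MvPolynomial (Fin s) S))
      (MvPolynomial.X i) = varVal S i := rfl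

theorem varVal_ne_constVal (S : Type*) [Field S] {s : ℕ} (i : Fin s) (x : S) :
    varVal S i ≠ constVal S s x := by
  intro h
  have h1 : (MvPolynomial.X i : MvPolynomial (Fin s) S) = MvPolynomial.C x :=
    IsFractionRing.injective _ (FractionRing (MvPolynomial (Fin s) S)) h
  have h2 := congrArg (MvPolynomial.eval fun _ => x + 1) h1
  simp at h2

/-- Products of Lagrange basis polynomials in independent variables are linearly independent:
evaluation of the variables at the nodes isolates the coefficients. -/
theorem eq_zero_of_sum_prod_lagrangeBasis {S : Type*} [Field S] {s q m : ℕ} {y : S}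
    (hy : ∀ i < m, ∀ j < m, y ^ q ^ i = y ^ q ^ j → i = j) (c : (Fin s → ℕ) → S)
    (h : ∑ k ∈ Fintype.piFinset fun _ : Fin s => Finset.range m,
      (∏ i, lagrangeBasis q m (constVal S s y) (varVal S i) (k i)) * constVal S s (c k) = 0)
    {l : Fin s → ℕ} (hl : ∀ i, l i < m) : c l = 0 := by
  let Q : (Fin s → ℕ) → MvPolynomial (Fin s) S := fun k =>
    ∏ i, ∏ j ∈ (Finset.range m).erase (k i), (MvPolynomial.X i - MvPolynomial.C (y ^ q ^ j)) *
      MvPolynomial.C (y ^ q ^ k i - y ^ q ^ j)⁻¹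
  have h1 : ∀ k, algebraMap _ (FractionRing (MvPolynomial (Fin s) S)) (Q k) =
      ∏ i, lagrangeBasis q m (constVal S s y) (varVal S i) (k i) := by
    intro k
    simp only [Q, lagrangeBasis, map_prod, map_mul, map_sub, algebraMap_C_eq_constVal,
      algebraMap_X_eq_varVal, map_inv₀, map_pow, div_eq_mul_inv]
  have h2 : ∀ k ∈ Fintype.piFinset fun _ : Fin s => Finset.range m,
      MvPolynomial.eval (fun i => y ^ q ^ l i) (Q k) = if k = l then 1 else 0 := by
    intro k hk
    have hkm : ∀ i, k i < m := fun i => Finset.mem_range.1 (Fintype.mem_piFinset.1 hk i)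
    have : MvPolynomial.eval (fun i => y ^ q ^ l i) (Q k) =
        ∏ i, lagrangeBasis q m y (y ^ q ^ l i) (k i) := by
      simp only [Q, lagrangeBasis, map_prod, map_mul, map_sub, MvPolynomial.eval_X,
        MvPolynomial.eval_C, div_eq_mul_inv]
    simp_rw [this, lagrangeBasis_node hy (hkm _) (hl _)]
    rw [Finset.prod_ite_zero]
    simp [funext_iff]
  have h3 : ∑ k ∈ Fintype.piFinset fun _ : Fin s => Finset.range m,
      Q k * MvPolynomial.C (c k) = 0 := by
    apply IsFractionRing.injective _ (FractionRing (MvPolynomial (Fin s) S))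
    rw [map_zero, ← h, map_sum]
    refine Finset.sum_congr rfl fun k _ => ?_
    rw [map_mul, h1, algebraMap_C_eq_constVal]
  have h4 := congrArg (MvPolynomial.eval fun i => y ^ q ^ l i) h3
  rw [map_sum, map_zero, Finset.sum_eq_single_of_mem l
    (Fintype.mem_piFinset.2 fun i => Finset.mem_range.2 (hl i))] at h4
  · simpa [h2 l (Fintype.mem_piFinset.2 fun i => Finset.mem_range.2 (hl i))] using h4
  · intro k hk hkl
    rw [map_mul, h2 k hk, if_neg hkl, zero_mul]

theorem exists_sum_pow_eq {q : ℕ} (hq : 1 < q) {m : ℕ} (hm : m ≠ 0) :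
    ∃ l : Fin (m * (q - 1) + 1) → ℕ, (∀ i, l i < m) ∧ ∑ i, q ^ l i = q ^ m := by
  refine ⟨Fin.snoc (fun i : Fin (m * (q - 1)) => (i : ℕ) / (q - 1)) 0, ?_, ?_⟩
  · intro i
    refine Fin.lastCases ?_ (fun j => ?_) i
    · simpa using Nat.pos_of_ne_zero hm
    · rw [Fin.snoc_castSucc]
      exact Nat.div_lt_of_lt_mul (j.2.trans_eq (mul_comm _ _))
  · rw [Fin.sum_univ_castSucc, ← sum_pow_div_add_one hq m, Finset.sum_range]
    simp

variable [Fintype F]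

theorem algebraMap_piFactor (s d : ℕ) :
    algebraMap _ (FractionRing (MvPolynomial (Fin s) (RatFunc F))) (piFactor F s d) =
      (lProd (Fintype.card F) (d - 1) (constVal (RatFunc F) s RatFunc.X))⁻¹ *
        ∏ i : Fin s, bProd (Fintype.card F) (d - mOf F s)
          (constVal (RatFunc F) s RatFunc.X) (varVal (RatFunc F) i) := by
  rw [piFactor, map_mul, map_prod, algebraMap_C_eq_constVal, map_inv₀]
  simp only [lCarlitz, bCarlitz, map_prod, map_sub, map_pow, algebraMap_C_eq_constVal,
    algebraMap_X_eq_varVal]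
  rfl

theorem algebraMap_piFactor_ne_zero (s d : ℕ) :
    algebraMap _ (FractionRing (MvPolynomial (Fin s) (RatFunc F))) (piFactor F s d) ≠ 0 := by
  have hθ := transcendental_constVal_X (F := F) s
  rw [algebraMap_piFactor]
  refine mul_ne_zero (inv_ne_zero (lProd_ne_zero hθ _)) ?_
  refine Finset.prod_ne_zero_iff.2 fun i _ => Finset.prod_ne_zero_iff.2 fun j _ => ?_
  rw [sub_ne_zero, ← map_pow]
  exact varVal_ne_constVal _ _ _

theorem Interpolates.unique {s : ℕ} {H H' : RatYT F s} (h : Interpolates H)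
    (h' : Interpolates H') : H' = H := by
  have hd : ∀ n : ℕ, 1 ≤ n + 1 + mOf F s ∧ mOf F s ≤ n + 1 + mOf F s := fun n => by omega
  choose v hv hv' using fun n : ℕ => h (n + 1 + mOf F s) (hd n).1 (hd n).2
  choose w hw hw' using fun n : ℕ => h' (n + 1 + mOf F s) (hd n).1 (hd n).2
  have hvw : w = v := by
    funext n
    exact mul_left_cancel₀ (algebraMap_piFactor_ne_zero s _) ((hw' n).symm.trans (hv' n))
  subst hvw
  refine HasValue.eq_of_infinite (IsFractionRing.injective F[X] (RatFunc F)) ?_ hw hv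
  intro i j hij
  simp only [Nat.add_sub_cancel] at hij
  rw [← RatFunc.algebraMap_X, ← map_pow, ← map_pow] at hij
  have h2 := congrArg natDegree (IsFractionRing.injective F[X] (RatFunc F) hij)
  rw [natDegree_X_pow, natDegree_X_pow] at h2
  exact Nat.succ_injective (Nat.pow_right_injective Fintype.one_lt_card h2)

/-- For `s = 1` the fraction is `1 / (t_1 - θ)`. -/
theorem exists_interpolates_one : ∃ H : RatYT F 1, Interpolates H ∧
    ∃ h, HasValue (toKperf F) (thetaRoot F (mOf F 1)) H h ∧ h ≠ 0 := by
  have hm : mOf F 1 = 0 := by simp [mOf]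
  refine ⟨(ratT F 0 - ratTheta F 1)⁻¹, fun d hd _ => ⟨_, (HasValue.sub (HasValue.ratT 0)
    HasValue.ratTheta).inv (sub_ne_zero.2 (varVal_ne_constVal _ _ _)), ?_⟩, _,
    (HasValue.sub (HasValue.ratT 0) HasValue.ratTheta).inv
      (sub_ne_zero.2 (varVal_ne_constVal _ _ _)),
    inv_ne_zero (sub_ne_zero.2 (varVal_ne_constVal _ _ _))⟩
  have hq : 1 < Fintype.card F := Fintype.one_lt_card
  have hθ := transcendental_constVal_X (F := F) 1
  rw [algebraMap_harmonicSum one_ne_zero rfl, algebraMap_piFactor, hm, RatFunc.algebraMap_X,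
    Nat.sub_zero, Fin.prod_univ_one, mul_assoc, ← div_eq_mul_inv,
    ← lagrangeBasis_zero _ (by omega) (varVal_ne_constVal _ _ _)]
  simp_rw [Fin.prod_univ_one, aeval_polyOf_eq_sum hθ _ (varVal (RatFunc F) (0 : Fin 1)),
    Finset.sum_div]
  rw [Finset.sum_comm]
  simp_rw [mul_div_assoc, ← Finset.mul_sum]
  change -∑ j ∈ Finset.range d, _ * shiftedPowerSum F _ d _ = _
  rw [Finset.sum_eq_single_of_mem 0 (by simpa using Nat.pos_of_ne_zero (by omega))]
  · simp [shiftedPowerSum_one hθ (show d ≠ 0 by omega)]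
  · intro j hj hj0
    rw [Finset.mem_range] at hj
    rw [shiftedPowerSum_pow_eq_zero hθ hj0 hj, mul_zero]

theorem exists_interpolates_of_ne_zero {m : ℕ} (hm : m ≠ 0) :
    ∃ H : RatYT F (m * (Fintype.card F - 1) + 1), Interpolates H ∧
      ∃ h, HasValue (toKperf F) (thetaRoot F (mOf F (m * (Fintype.card F - 1) + 1))) H h ∧
        h ≠ 0 := by
  have hq : 1 < Fintype.card F := Fintype.one_lt_card
  set s := m * (Fintype.card F - 1) + 1 with hs
  have hms : mOf F s = m := by
    rw [mOf, hs, Nat.add_sub_cancel, Nat.mul_div_cancel _ (by omega)]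
  have hs2 : 2 ≤ s := by
    have : 0 < m * (Fintype.card F - 1) := Nat.mul_pos (by omega) (by omega)
    omega
  have hθ := transcendental_constVal_X (F := F) s
  have hex : ∀ k ∈ Fintype.piFinset fun _ : Fin s => Finset.range m, _ := fun k hk =>
    exists_hasValue_normalizedPowerSum (F := F) s (N := ∑ i, Fintype.card F ^ k i) hm (by
      refine hs2.trans ?_
      have := Finset.sum_le_sum (s := Finset.univ) (f := fun _ : Fin s => 1)
        (g := fun i => Fintype.card F ^ k i) fun i _ => Nat.one_le_pow _ _ (by omega)
      simpa using this) (by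
      have := IsPowSum.sum_pow (q := Fintype.card F) (B := m) Finset.univ k fun i _ =>
        (Finset.mem_range.1 (Fintype.mem_piFinset.1 hk i)).le
      simpa using this)
  choose! h h1 h2 using hex
  set q := Fintype.card F with hq'
  set θ := constVal (RatFunc F) s RatFunc.X with hθ'
  set y := constVal (Kperf F) s (thetaRoot F m) with hy
  set T := Fintype.piFinset fun _ : Fin s => Finset.range m with hT
  have hTm : ∀ k ∈ T, ∀ i, k i < m := fun k hk i =>
    Finset.mem_range.1 (Fintype.mem_piFinset.1 hk i)
  have hner : ∀ i j, i ≠ j → y ^ q ^ i ≠ y ^ q ^ j := fun i j => constVal_thetaRoot_pow_ne s m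
  have hner' : ∀ j, 1 ≤ j → y ^ q ^ j ≠ y := fun j hj => by
    simpa using hner j 0 (by omega)
  have hγ : ∀ k < m, gammaFactor q (constVal (Kperf F) s (toKperf F X)) y k ≠ 0 := fun k hk =>
    gammaFactor_ne_zero_of_forall (fun j hj _ => hner' j hj) fun j _ hj => by
      rw [← constVal_thetaRoot_pow s m]
      exact hner j m (by omega)
  refine ⟨∑ k ∈ T, (∏ i, lagrangeBasis q m (ratY F s) (ratT F i) (k i) /
    gammaFactor q (ratTheta F s) (ratY F s) (k i)) * h k, ?_, ?_⟩
  · intro d hd hmd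
    rw [hms] at hmd ⊢
    obtain ⟨n, rfl⟩ := Nat.exists_eq_add_of_le' hmd
    rw [Nat.add_sub_cancel]
    refine ⟨∑ k ∈ T, (∏ i, lagrangeBasis q m (θ ^ q ^ n) (varVal (RatFunc F) i) (k i) /
        gammaFactor q θ (θ ^ q ^ n) (k i)) * normalizedPowerSum F θ m n (∑ i, q ^ k i),
      HasValue.sum T fun k hk => (HasValue.prod Finset.univ fun i _ =>
      (HasValue.lagrangeBasis (hasValue_ratY_pow s n) (HasValue.ratT i) fun j _ hj =>
        constVal_X_pow_ne s n hj.symm).div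
      (HasValue.gammaFactor (hasValue_ratTheta_X s n) (hasValue_ratY_pow s n) fun j hj _ => ?_)
      (gammaFactor_ne_zero hθ n (k i))).mul (h1 k hk n), ?_⟩
    · simpa using constVal_X_pow_ne s n (i := j) (j := 0) (by omega)
    · rw [algebraMap_harmonicSum (by omega)
        (by change (m * (q - 1) + 1) % (q - 1) = 1 % (q - 1); simp)]
      rw [algebraMap_piFactor, hms, Nat.add_sub_cancel]
      exact sum_prod_aeval_div_eq_normalized hθ n hm _
  · rw [hms]
    refine ⟨∑ k ∈ T, (∏ i, lagrangeBasis q m y (varVal (Kperf F) i) (k i) /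
        gammaFactor q (constVal (Kperf F) s (toKperf F X)) y (k i)) *
          (if ∑ i, q ^ k i = q ^ m then constVal (Kperf F) s
            (baseValue q m (toKperf F X) (thetaRoot F m)) else 0),
      HasValue.sum T fun k hk => (HasValue.prod Finset.univ fun i _ =>
        (HasValue.lagrangeBasis HasValue.ratY (HasValue.ratT i) fun j _ hj =>
          hner _ _ hj.symm).div
        (HasValue.gammaFactor HasValue.ratTheta HasValue.ratY fun j hj _ => hner' j hj)
        (hγ _ (hTm k hk i))).mul (h2 k hk), ?_⟩
    intro h0
    obtain ⟨l, hl, hlsum⟩ := exists_sum_pow_eq hq hm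
    have h3 := eq_zero_of_sum_prod_lagrangeBasis (y := thetaRoot F m) (q := q) (m := m)
      (fun i _ j _ hij => by_contra fun hne => thetaRoot_pow_ne m hne hij)
      (fun k => if ∑ i, q ^ k i = q ^ m then
        (∏ i, gammaFactor q (toKperf F X) (thetaRoot F m) (k i))⁻¹ *
          baseValue q m (toKperf F X) (thetaRoot F m) else 0) (by
        refine Eq.trans (Finset.sum_congr rfl fun k _ => ?_) h0
        rw [Finset.prod_div_distrib]
        split_ifs
        · rw [map_mul, map_inv₀, map_prod]
          simp_rw [map_gammaFactor]
          rw [div_eq_mul_inv, mul_assoc]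
        · rw [map_zero, mul_zero, mul_zero]) hl
    rw [if_pos hlsum] at h3
    refine (mul_ne_zero (inv_ne_zero (Finset.prod_ne_zero_iff.2 fun i _ => ?_)) ?_) h3
    · intro h4
      have := hγ (l i) (hl i)
      rw [hy, ← map_gammaFactor, h4, map_zero] at this
      exact this rfl
    · have h5 : ∀ i j, i ≠ j → thetaRoot F m ^ q ^ i - thetaRoot F m ^ q ^ j ≠ 0 :=
        fun i j hij => sub_ne_zero.2 (thetaRoot_pow_ne m hij)
      refine mul_ne_zero (div_ne_zero (pow_ne_zero _ fun h4 => ?_) ?_)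
        (Finset.prod_ne_zero_iff.2 fun j hj => h5 _ _ ?_)
      · have := hγ (m - 1) (by omega)
        rw [hy, ← map_gammaFactor, h4, map_zero] at this
        exact this rfl
      · simpa using h5 m 0 hm
      · rw [Finset.mem_range] at hj
        omega

theorem exists_interpolates {s : ℕ} (hs : 1 ≤ s) (hmod : s ≡ 1 [MOD Fintype.card F - 1]) :
    ∃ H : RatYT F s, Interpolates H ∧
      ∃ h, HasValue (toKperf F) (thetaRoot F (mOf F s)) H h ∧ h ≠ 0 := by
  obtain ⟨m, hm⟩ : Fintype.card F - 1 ∣ s - 1 := (Nat.modEq_iff_dvd' hs).1 hmod.symm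
  obtain rfl : s = m * (Fintype.card F - 1) + 1 := by rw [mul_comm]; omega
  rcases eq_or_ne m 0 with rfl | hm0
  · rw [zero_mul]
    exact exists_interpolates_one
  · exact exists_interpolates_of_ne_zero hm0

end Existence

/-! ### Roots of a prime in its residue field -/

section FrobeniusRoots

variable {F : Type*} [Field F] [Fintype F] {k : Type*} [Field k] [Algebra F k] {x : k} {P : F[X]}

/-- The conjugates `x ^ (q ^ i)` with `i < deg P` of a root of an irreducible polynomial `P` are
distinct: otherwise all the `q ^ deg P` elements of `F[x]` would be roots of `T ^ (q ^ r) - T` for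
some `0 < r < deg P`. -/
theorem pow_card_pow_ne_self (hP : Irreducible P) (hx : aeval x P = 0) {r : ℕ} (hr0 : r ≠ 0)
    (hr : r < P.natDegree) : x ^ Fintype.card F ^ r ≠ x := by
  classical
  intro h
  have hq : 1 < Fintype.card F := Fintype.one_lt_card
  have hinj : Function.Injective fun c : Fin P.natDegree → F => aeval x (polyOf c) := by
    intro c c' hc
    have h1 : aeval x (polyOf c - polyOf c') = 0 := by
      rw [map_sub]; exact sub_eq_zero.2 hc
    have h2 : P ∣ polyOf c - polyOf c' := by
      have h3 : minpoly F x ∣ P := minpoly.dvd F x hx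
      have hint : IsIntegral F x := IsAlgebraic.isIntegral ⟨P, hP.ne_zero, hx⟩
      have h4 := (minpoly.irreducible hint).associated_of_dvd hP h3
      exact h4.symm.dvd.trans (minpoly.dvd F x h1)
    refine polyOf_injective (sub_eq_zero.1 (eq_zero_of_dvd_of_degree_lt h2 ?_))
    refine (degree_sub_le _ _).trans_lt (max_lt ?_ ?_)
    · exact (degree_polyOf_lt c).trans_eq (degree_eq_natDegree hP.ne_zero).symm
    · exact (degree_polyOf_lt c').trans_eq (degree_eq_natDegree hP.ne_zero).symm
  have hX : (X ^ Fintype.card F ^ r - X : k[X]) ≠ 0 :=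
    FiniteField.X_pow_card_sub_X_ne_zero k (Nat.one_lt_pow hr0 hq)
  have hsub : Finset.univ.image (fun c : Fin P.natDegree → F => aeval x (polyOf c)) ⊆
      (X ^ Fintype.card F ^ r - X : k[X]).roots.toFinset := by
    intro z hz
    obtain ⟨c, -, rfl⟩ := Finset.mem_image.1 hz
    rw [Multiset.mem_toFinset, mem_roots hX, IsRoot.def, eval_sub, eval_pow, eval_X,
      aeval_pow_card, h, sub_self]
  have h1 := Finset.card_le_card hsub
  rw [Finset.card_image_of_injective _ hinj, Finset.card_univ, Fintype.card_fun,
    Fintype.card_fin] at h1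
  have h2 := (Multiset.toFinset_card_le _).trans
    (card_roots' (X ^ Fintype.card F ^ r - X : k[X]))
  rw [FiniteField.X_pow_card_sub_X_natDegree_eq k (Nat.one_lt_pow hr0 hq)] at h2
  have h3 := Nat.pow_lt_pow_right hq hr
  omega

theorem pow_card_pow_ne_of_irreducible (hP : Irreducible P) (hx : aeval x P = 0) {i j : ℕ}
    (hij : i < j) (hj : j - i < P.natDegree) :
    x ^ Fintype.card F ^ i ≠ x ^ Fintype.card F ^ j := by
  intro h
  obtain ⟨r, rfl⟩ := Nat.exists_eq_add_of_lt hij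
  have h1 : (x ^ Fintype.card F ^ (r + 1)) ^ Fintype.card F ^ i = x ^ Fintype.card F ^ i := by
    rw [h, ← pow_mul, ← pow_add]
    congr 2
    omega
  refine pow_card_pow_ne_self hP hx (r := r + 1) (by omega) (by omega) ?_
  have hinj := (FiniteField.frobeniusAlgHom F k).toRingHom.injective.iterate i
  have hpow : (FiniteField.frobeniusAlgHom F k).toRingHom^[i] =
      fun z : k => z ^ Fintype.card F ^ i := pow_iterate _ _
  rw [hpow] at hinj
  exact hinj h1

theorem map_eq_prod_X_sub_C (hP : Irreducible P) (hm : P.Monic) (hx : aeval x P = 0) :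
    P.map (algebraMap F k) =
      ∏ i ∈ Finset.range P.natDegree, (X - C (x ^ Fintype.card F ^ i)) := by
  have hinj : Set.InjOn (fun i : ℕ => x ^ Fintype.card F ^ i) (Finset.range P.natDegree) := by
    intro i hi j hj h
    rw [Finset.mem_coe, Finset.mem_range] at hi hj
    rcases lt_trichotomy i j with hij | hij | hij
    · exact absurd h (pow_card_pow_ne_of_irreducible hP hx hij (by omega))
    · exact hij
    · exact absurd h.symm (pow_card_pow_ne_of_irreducible hP hx hij (by omega))
  refine eq_of_monic_of_dvd_of_natDegree_le (monic_prod_of_monic _ _ fun i _ => monic_X_sub_C _)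
    (hm.map _) (Finset.prod_dvd_of_coprime ?_ fun i _ => ?_) ?_
  · intro i hi j hj hij
    exact isCoprime_X_sub_C_of_isUnit_sub (sub_ne_zero.2 fun h => hij (hinj hi hj h)).isUnit
  · rw [dvd_iff_isRoot, IsRoot.def, eval_map_algebraMap, ← aeval_pow_card, hx, zero_pow]
    exact pow_ne_zero _ Fintype.card_ne_zero
  · rw [natDegree_map, natDegree_prod_of_monic _ _ fun i _ => monic_X_sub_C _]
    simp only [natDegree_X_sub_C, Finset.sum_const, Finset.card_range, smul_eq_mul, mul_one,
      le_refl]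

theorem pow_card_pow_natDegree (hP : Irreducible P) (hm : P.Monic) (hx : aeval x P = 0) :
    x ^ Fintype.card F ^ P.natDegree = x := by
  have h1 : aeval (x ^ Fintype.card F ^ P.natDegree) P = 0 := by
    rw [← aeval_pow_card, hx, zero_pow (pow_ne_zero _ Fintype.card_ne_zero)]
  rw [← eval_map_algebraMap, map_eq_prod_X_sub_C hP hm hx, eval_prod,
    Finset.prod_eq_zero_iff] at h1
  obtain ⟨i, hi, h2⟩ := h1
  rw [eval_sub, eval_X, eval_C, sub_eq_zero] at h2
  rw [Finset.mem_range] at hi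
  rcases Nat.eq_zero_or_pos i with rfl | hi0
  · simpa using h2
  · exact absurd h2.symm (pow_card_pow_ne_of_irreducible hP hx hi (by omega))

theorem aeval_derivative_eq_prod (hP : Irreducible P) (hm : P.Monic) (hx : aeval x P = 0) :
    aeval x (derivative P) = lProd (Fintype.card F) (P.natDegree - 1) x := by
  obtain ⟨d, hd⟩ := Nat.exists_eq_succ_of_ne_zero hP.natDegree_pos.ne'
  have hIcc : ∏ i ∈ Finset.Icc 1 d, (x - x ^ Fintype.card F ^ i) =
      ∏ i ∈ Finset.range d, (x - x ^ Fintype.card F ^ (i + 1)) := by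
    rw [Finset.range_eq_Ico, Finset.prod_Ico_add' (fun i => x - x ^ Fintype.card F ^ i) 0 d 1]
    rfl
  rw [← eval_map_algebraMap, ← derivative_map, map_eq_prod_X_sub_C hP hm hx, hd,
    Finset.prod_range_succ', derivative_mul, lProd, Nat.succ_sub_one, hIcc]
  simp [eval_prod]

end FrobeniusRoots

section Residue

variable {F : Type*} [Field F] (E : Type*) [Field E] [Algebra F E]

theorem resMk_eq_zero_iff {P : Primes F} {f : E[X]} :
    resMk P f = 0 ↔ P.1.map (algebraMap F E) ∣ f :=
  Ideal.Quotient.eq_zero_iff_mem.trans Ideal.mem_span_singleton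

theorem eval₂_resMk (P : Primes F) (f : F[X]) :
    f.eval₂ ((resMk P).comp (C.comp (algebraMap F E))) (resMk P X : Res F E P) =
      resMk P (f.map (algebraMap F E)) :=
  (hom_eval₂ f (C.comp (algebraMap F E)) (resMk P) X).symm

/-- The map `F[θ]/P → E[θ]/P`. -/
def residueMap (P : Primes F) : AdjoinRoot P.1 →+* Res F E P :=
  AdjoinRoot.lift ((resMk P).comp (C.comp (algebraMap F E))) (resMk P X)
    ((eval₂_resMk E P P.1).trans ((resMk_eq_zero_iff E).2 dvd_rfl))

theorem residueMap_root (P : Primes F) :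
    residueMap E P (AdjoinRoot.root P.1) = resMk P X :=
  AdjoinRoot.lift_root _

theorem residueMap_aeval_root (P : Primes F) (f : F[X]) :
    residueMap E P (aeval (AdjoinRoot.root P.1) f) = resMk P (f.map (algebraMap F E)) := by
  rw [AdjoinRoot.aeval_eq, residueMap, AdjoinRoot.lift_mk, eval₂_resMk]

variable [Fintype F]

theorem resMk_X_pow_card (P : Primes F) :
    (resMk P X : Res F E P) ^ Fintype.card F ^ P.1.natDegree = resMk P X := by
  have : Fact (Irreducible P.1) := ⟨P.2.2⟩
  rw [← residueMap_root, ← map_pow,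
    pow_card_pow_natDegree P.2.2 P.2.1 (by rw [AdjoinRoot.aeval_eq, AdjoinRoot.mk_self])]

/-- `P' = l_{deg P - 1}` modulo `P`. -/
theorem resMk_derivative (P : Primes F) :
    (resMk P ((derivative P.1).map (algebraMap F E)) : Res F E P) =
      ∏ i ∈ Finset.Icc 1 (P.1.natDegree - 1),
        (resMk P X - resMk P X ^ Fintype.card F ^ i) := by
  have : Fact (Irreducible P.1) := ⟨P.2.2⟩
  rw [← residueMap_aeval_root, aeval_derivative_eq_prod P.2.2 P.2.1
    (by rw [AdjoinRoot.aeval_eq, AdjoinRoot.mk_self]), lProd]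
  simp only [map_prod, map_sub, map_pow, residueMap_root]

/-- `P(t) = b_{deg P}(t)` modulo `P`. -/
theorem resMk_C_aeval (P : Primes F) (t : E) :
    (resMk P (C (aeval t P.1)) : Res F E P) =
      ∏ i ∈ Finset.range P.1.natDegree,
        (resMk P (C t) - resMk P X ^ Fintype.card F ^ i) := by
  have : Fact (Irreducible P.1) := ⟨P.2.2⟩
  have h := congrArg (eval₂ (residueMap E P) (resMk P (C t)))
    (map_eq_prod_X_sub_C P.2.2 P.2.1 (x := AdjoinRoot.root P.1)
      (by rw [AdjoinRoot.aeval_eq, AdjoinRoot.mk_self]))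
  rw [eval₂_map, eval₂_finsetProd] at h
  simp only [eval₂_sub, eval₂_X, eval₂_C] at h
  simp only [map_pow, residueMap_root] at h
  rw [← h, aeval_def, hom_eval₂, hom_eval₂]
  congr 1
  ext a
  simp [residueMap, AdjoinRoot.algebraMap_eq]

end Residue

/-! ### Reduction of `P`-integral elements of `K[t_1, …, t_s]` -/

section Reduction

variable {F : Type*} [Field F]

theorem isCoprime_map {P : Primes F} (E : Type*) [Field E] [Algebra F E] {g : F[X]}
    (h : IsCoprime g P.1) : IsCoprime (g.map (algebraMap F E)) (P.1.map (algebraMap F E)) :=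
  h.map (mapRingHom (algebraMap F E))

/-- `redCoeff`, defined by the reduced fraction, may be computed from any fraction with
denominator prime to `P`. -/
theorem redCoeff_mul (E : Type*) [Field E] [Algebra F E] {P : Primes F} {c : RatFunc F}
    {g f : F[X]} (hg : IsCoprime g P.1)
    (h : algebraMap F[X] (RatFunc F) g * c = algebraMap F[X] (RatFunc F) f) :
    redCoeff E P c * resMk P (g.map (algebraMap F E)) = resMk P (f.map (algebraMap F E)) := by
  have hd : algebraMap F[X] (RatFunc F) c.denom ≠ 0 := by
    simpa using c.denom_ne_zero
  have h1 : g * c.num = f * c.denom := by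
    apply IsFractionRing.injective F[X] (RatFunc F)
    rw [map_mul, map_mul, ← h, mul_assoc]
    congr 1
    exact (div_eq_iff hd).1 (RatFunc.num_div_denom c)
  have h2 : c.denom ∣ g :=
    (RatFunc.isCoprime_num_denom c).symm.dvd_of_dvd_mul_right (h1 ▸ Dvd.intro_left _ rfl)
  have h3 := resMk_isUnit (isCoprime_map E (hg.of_isCoprime_of_dvd_left h2))
  rw [redCoeff, mul_right_comm, ← map_mul, ← Polynomial.map_mul, mul_comm c.num, h1,
    Polynomial.map_mul, map_mul, mul_assoc, Ring.mul_inverse_cancel _ h3, mul_one]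

/-- Reduction modulo `P` on `A[t_1, …, t_s]`. -/
def intRed (s : ℕ) (P : Primes F) : MvPolynomial (Fin s) F[X] →+* Res F (Fs F s) P :=
  MvPolynomial.eval₂Hom ((resMk P).comp (mapRingHom (algebraMap F (Fs F s))))
    fun i => resMk P (C (tVar F i))

theorem intRed_C {s : ℕ} (P : Primes F) (a : F[X]) :
    intRed s P (MvPolynomial.C a) = resMk P (a.map (algebraMap F (Fs F s))) := by
  simp [intRed]

theorem intRed_X {s : ℕ} (P : Primes F) (i : Fin s) :
    intRed s P (MvPolynomial.X i) = resMk P (C (tVar F i)) := by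
  simp [intRed]

/-- The inclusion of `A[t_1, …, t_s]` in `K[t_1, …, t_s]`. -/
def intIncl (F : Type*) [Field F] (s : ℕ) :
    MvPolynomial (Fin s) F[X] →+* MvPolynomial (Fin s) (RatFunc F) :=
  MvPolynomial.map (algebraMap F[X] (RatFunc F))

/-- `redPoly` is compatible with clearing denominators prime to `P`. -/
theorem redPoly_mul {s : ℕ} {P : Primes F} {f : MvPolynomial (Fin s) (RatFunc F)} {g : F[X]}
    {N : MvPolynomial (Fin s) F[X]} (hg : IsCoprime g P.1)
    (h : intIncl F s (MvPolynomial.C g) * f = intIncl F s N) :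
    redPoly P f * intRed s P (MvPolynomial.C g) = intRed s P N := by
  have hc : ∀ e, algebraMap F[X] (RatFunc F) g * f.coeff e =
      algebraMap F[X] (RatFunc F) (N.coeff e) := by
    intro e
    have := congrArg (MvPolynomial.coeff e) h
    rwa [intIncl, MvPolynomial.map_C, MvPolynomial.coeff_C_mul, MvPolynomial.coeff_map] at this
  have hsub : N.support ⊆ f.support := by
    intro e he
    rw [MvPolynomial.mem_support_iff] at he ⊢
    intro h0
    have := hc e
    rw [h0, mul_zero] at this
    exact he (by simpa using this.symm)
  rw [intRed_C, redPoly, intRed, MvPolynomial.coe_eval₂Hom, MvPolynomial.eval₂_eq,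
    Finset.sum_mul, Finset.sum_subset hsub]
  · refine Finset.sum_congr rfl fun e _ => ?_
    rw [mul_right_comm, redCoeff_mul _ hg (hc e), MvPolynomial.monomial_eq, MvPolynomial.C_1,
      one_mul, Finsupp.prod, map_prod, map_prod, map_prod]
    simp only [map_pow]
    rfl
  · intro e _ he
    rw [MvPolynomial.notMem_support_iff.1 he, map_zero, zero_mul]

theorem isCoprime_of_natDegree_lt {P : Primes F} {a : F[X]} (ha : a ≠ 0)
    (h : a.natDegree < P.1.natDegree) : IsCoprime a P.1 := by
  refine (P.2.2.coprime_iff_not_dvd.2 fun hd => ?_).symm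
  have := natDegree_le_of_dvd hd ha
  omega

theorem exists_intIncl_sum {s : ℕ} {P : Primes F} {ι : Type*} (u : Finset ι)
    (f : ι → MvPolynomial (Fin s) (RatFunc F))
    (h : ∀ i ∈ u, ∃ (g : F[X]) (N : MvPolynomial (Fin s) F[X]), IsCoprime g P.1 ∧
      intIncl F s (MvPolynomial.C g) * f i = intIncl F s N) :
    ∃ (g : F[X]) (N : MvPolynomial (Fin s) F[X]), IsCoprime g P.1 ∧
      intIncl F s (MvPolynomial.C g) * ∑ i ∈ u, f i = intIncl F s N := by
  classical
  induction u using Finset.induction_on with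
  | empty => exact ⟨1, 0, isCoprime_one_left, by simp⟩
  | insert i u hi ih =>
    obtain ⟨g, N, hg, hN⟩ := ih fun j hj => h j (Finset.mem_insert_of_mem hj)
    obtain ⟨g', N', hg', hN'⟩ := h i (Finset.mem_insert_self i u)
    refine ⟨g * g', MvPolynomial.C g * N' + MvPolynomial.C g' * N, hg.mul_left hg', ?_⟩
    rw [Finset.sum_insert hi, map_mul, map_mul, map_add, map_mul, map_mul, ← hN, ← hN']
    ring

variable [Fintype F]

/-- The denominators of `F_{deg P}(1; s)` are prime to `P`, being of smaller degree. -/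
theorem exists_intIncl_harmonicSum (P : Primes F) (s : ℕ) :
    ∃ (g : F[X]) (N : MvPolynomial (Fin s) F[X]), IsCoprime g P.1 ∧
      intIncl F s (MvPolynomial.C g) * harmonicSum F P.1.natDegree 1 s = intIncl F s N := by
  refine exists_intIncl_sum _ _ fun i hi => exists_intIncl_sum _ _ fun a ha => ?_
  rw [Finset.mem_range] at hi
  rw [mem_Aplus] at ha
  refine ⟨a, ∏ j, aeval (MvPolynomial.X j) a,
    isCoprime_of_natDegree_lt ha.1.ne_zero (ha.2.trans_lt hi), ?_⟩
  have h0 : algebraMap F[X] (RatFunc F) a ≠ 0 := by simpa using ha.1.ne_zero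
  rw [zpow_one, intIncl, MvPolynomial.map_C, ← mul_assoc, ← MvPolynomial.C_mul,
    mul_inv_cancel₀ h0, MvPolynomial.C_1, one_mul, map_prod]
  refine Finset.prod_congr rfl fun j _ => ?_
  rw [aeval_def, aeval_def, hom_eval₂, MvPolynomial.map_X]
  congr 1
  ext1 x
  rw [IsScalarTower.algebraMap_apply F (RatFunc F) (MvPolynomial (Fin s) (RatFunc F)),
    IsScalarTower.algebraMap_apply F F[X] (RatFunc F), RingHom.comp_apply,
    IsScalarTower.algebraMap_apply F F[X] (MvPolynomial (Fin s) F[X]),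
    MvPolynomial.algebraMap_eq, MvPolynomial.algebraMap_eq, MvPolynomial.map_C]

end Reduction

/-! ### Reduction of the interpolation formula -/

section Formula

variable {F : Type*} [Field F]

theorem intIncl_injective (s : ℕ) : Function.Injective (intIncl F s) :=
  MvPolynomial.map_injective _ (IsFractionRing.injective F[X] (RatFunc F))

/-- Substitution of the polynomial `θ ^ k` for `Y`. -/
def substY (s k : ℕ) : (MvPolynomial (Fin s) F[X])[X] →+* MvPolynomial (Fin s) F[X] :=
  evalRingHom (MvPolynomial.C (X ^ k))

theorem evalY_pow {s : ℕ} (k : ℕ) (N : (MvPolynomial (Fin s) F[X])[X]) :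
    evalY (algebraMap F[X] (RatFunc F)) (RatFunc.X ^ k) N = intIncl F s (substY s k N) := by
  rw [evalY, coe_eval₂RingHom, substY, coe_evalRingHom, intIncl, ← eval₂_hom]
  simp

variable [Fintype F]

/-- `b_n(t_i)` as an element of `A[t_1, …, t_s]`. -/
def intB (F : Type*) [Field F] [Fintype F] {s : ℕ} (n : ℕ) (i : Fin s) :
    MvPolynomial (Fin s) F[X] :=
  ∏ j ∈ Finset.range n, (MvPolynomial.X i - MvPolynomial.C (X ^ Fintype.card F ^ j))

/-- `l_n` as an element of `A`. -/
def intL (F : Type*) [Field F] [Fintype F] (n : ℕ) : F[X] :=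
  ∏ i ∈ Finset.Icc 1 n, (X - X ^ Fintype.card F ^ i)

theorem intIncl_intB {s : ℕ} (n : ℕ) (i : Fin s) : intIncl F s (intB F n i) = bCarlitz F n i := by
  simp [intB, bCarlitz, intIncl]

theorem algebraMap_intL (n : ℕ) : algebraMap F[X] (RatFunc F) (intL F n) = lCarlitz F n := by
  simp [intL, lCarlitz]

theorem intRed_intL {s : ℕ} (P : Primes F) :
    intRed s P (MvPolynomial.C (intL F (P.1.natDegree - 1))) =
      resMk P ((derivative P.1).map (algebraMap F (Fs F s))) := by
  rw [resMk_derivative, intRed_C, intL, Polynomial.map_prod, map_prod]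
  simp

theorem intRed_intB {s : ℕ} (P : Primes F) (n : ℕ) (i : Fin s) :
    intRed s P (intB F n i) = ∏ j ∈ Finset.range n,
      (resMk P (C (tVar F i)) - resMk P X ^ Fintype.card F ^ j) := by
  rw [intB, map_prod]
  simp [intRed_C, intRed_X]

theorem lCarlitz_ne_zero (n : ℕ) : lCarlitz F n ≠ 0 := by
  have := lProd_ne_zero (transcendental_constVal_X (F := F) 0) n
  intro h
  apply this
  rw [← map_zero (constVal (RatFunc F) 0), ← h, lCarlitz, lProd, map_prod]
  simp

/-- The reduction of the interpolation formula modulo `P`. -/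
theorem redPoly_harmonicSum_mul {s : ℕ} {H : RatYT F s} (hH : Interpolates H)
    {N D : (MvPolynomial (Fin s) F[X])[X]} (hND : H * algebraMap _ _ D = algebraMap _ _ N)
    (P : Primes F) (hP : mOf F s ≤ P.1.natDegree) :
    redPoly P (harmonicSum F P.1.natDegree 1 s) *
        resMk P ((derivative P.1).map (algebraMap F (Fs F s))) *
        intRed s P (substY s (Fintype.card F ^ (P.1.natDegree - mOf F s)) D) =
      (∏ i, intRed s P (intB F (P.1.natDegree - mOf F s) i)) *
        intRed s P (substY s (Fintype.card F ^ (P.1.natDegree - mOf F s)) N) := by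
  obtain ⟨v, hv, hFv⟩ := hH P.1.natDegree P.2.2.natDegree_pos hP
  have h1 := hv.mul_eq hND
  rw [evalY_pow, evalY_pow] at h1
  obtain ⟨g, M, hg, hM⟩ := exists_intIncl_harmonicSum P s
  set d := P.1.natDegree
  set k := Fintype.card F ^ (d - mOf F s)
  have h2 : harmonicSum F d 1 s * intIncl F s (substY s k D) =
      piFactor F s d * intIncl F s (substY s k N) := by
    apply IsFractionRing.injective _ (FractionRing (MvPolynomial (Fin s) (RatFunc F)))
    rw [map_mul, map_mul, hFv, ← h1, mul_assoc]
  have h3 : intIncl F s (MvPolynomial.C (intL F (d - 1))) * piFactor F s d =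
      ∏ i, intIncl F s (intB F (d - mOf F s) i) := by
    simp_rw [intIncl_intB]
    rw [intIncl, MvPolynomial.map_C, algebraMap_intL, piFactor, ← mul_assoc, ← MvPolynomial.C_mul,
      mul_inv_cancel₀ (lCarlitz_ne_zero _), MvPolynomial.C_1, one_mul]
  have h4 : M * MvPolynomial.C (intL F (d - 1)) * substY s k D =
      MvPolynomial.C g * (∏ i, intB F (d - mOf F s) i) * substY s k N := by
    apply intIncl_injective
    rw [map_mul, map_mul, map_mul, map_mul, map_prod, ← hM, ← h3]
    linear_combination intIncl F s (MvPolynomial.C g) *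
      intIncl F s (MvPolynomial.C (intL F (d - 1))) * h2
  have h5 := congrArg (intRed s P) h4
  rw [map_mul, map_mul, map_mul, map_mul, map_prod, ← redPoly_mul hg hM, intRed_intL] at h5
  have hu : IsUnit (intRed s P (MvPolynomial.C g)) := by
    rw [intRed_C]
    exact resMk_isUnit (isCoprime_map _ hg)
  refine hu.mul_left_cancel ?_
  linear_combination h5

end Formula

/-! ### The embedding `ι` and the roots of `θ` -/

section Iota

variable {F : Type*} [Field F] [Fintype F]

/-- The `q ^ j`-th power map is a power of the Frobenius map, which is injective on this perfect
ring. -/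
theorem resRing_pow_injective (j : ℕ) :
    Function.Injective fun x : ResRing F F => x ^ Fintype.card F ^ j := by
  have : Fact (ringChar F).Prime := ⟨CharP.char_is_prime F (ringChar F)⟩
  have : CharP (ResRing F F) (ringChar F) := resRing_charP _
  have : ExpChar (ResRing F F) (ringChar F) := ExpChar.prime Fact.out
  have : PerfectRing (ResRing F F) (ringChar F) := resRing_perfect _
  obtain ⟨k, -, hk⟩ := FiniteField.card F (ringChar F)
  have h := (bijective_iterateFrobenius (ResRing F F) (ringChar F) (k * j)).1
  intro x y hxy
  apply h
  simp only at hxy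
  rwa [hk, ← pow_mul] at hxy

theorem finite_natDegree_lt (j : ℕ) : {P : Primes F | P.1.natDegree < j}.Finite := by
  refine Set.Finite.of_finite_image (f := Subtype.val) ?_ Subtype.val_injective.injOn
  refine (Set.Finite.biUnion (Finset.range j).finite_toSet fun d _ =>
    (Aplus F d).finite_toSet).subset ?_
  rintro _ ⟨P, hP, rfl⟩
  simp only [Set.mem_iUnion]
  exact ⟨P.1.natDegree, by simpa using hP, (mem_Aplus F).2 ⟨P.2.1, rfl⟩⟩

/-- Modulo `P` the `q ^ j`-th root of `θ` is `θ ^ (q ^ (deg P - j))`. -/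
theorem iotaBase_thetaRoot (j : ℕ) :
    iotaBase F (thetaRoot F j) = famMk F F fun P =>
      resMk P X ^ Fintype.card F ^ (P.1.natDegree - j) := by
  apply resRing_pow_injective j
  simp only
  rw [← map_pow, thetaRoot_pow, iotaBase_toKperf, ← map_pow]
  change famMk F F (fun P => resMk P X) = _
  rw [famMk_eq_iff]
  refine (finite_natDegree_lt j).subset fun P hP => ?_
  by_contra h
  refine hP ?_
  rw [Set.mem_ofPred_eq, not_lt] at h
  rw [Pi.pow_apply, ← pow_mul, ← pow_add, Nat.sub_add_cancel h, resMk_X_pow_card]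

variable {s : ℕ}

theorem iotaPoly_C_thetaRoot (j : ℕ) :
    iotaPoly F s (MvPolynomial.C (thetaRoot F j)) = famMk F (Fs F s) fun P =>
      resMk P X ^ Fintype.card F ^ (P.1.natDegree - j) := by
  rw [iotaPoly, MvPolynomial.coe_eval₂Hom, MvPolynomial.eval₂_C, RingHom.comp_apply,
    iotaBase_thetaRoot]
  change famMk F (Fs F s) (fun P => resMap (Fs F s) P
    (resMk P X ^ Fintype.card F ^ (P.1.natDegree - j))) = _
  refine congrArg _ (funext fun P => ?_)
  rw [map_pow]
  congr 1
  change resMk P (X.map (algebraMap F (Fs F s))) = _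
  rw [map_X]

theorem iotaPoly_X (i : Fin s) :
    iotaPoly F s (MvPolynomial.X i) = famMk F (Fs F s) fun P => resMk P (C (tVar F i)) := by
  rw [iotaPoly, MvPolynomial.coe_eval₂Hom, MvPolynomial.eval₂_X]
  rfl

theorem iotaPoly_C_toKperf (a : F[X]) :
    iotaPoly F s (MvPolynomial.C (toKperf F a)) =
      famMk F (Fs F s) fun P => resMk P (a.map (algebraMap F (Fs F s))) := by
  rw [iotaPoly, MvPolynomial.coe_eval₂Hom, MvPolynomial.eval₂_C, RingHom.comp_apply,
    iotaBase_toKperf, resRingMap_diag]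
  rfl

/-- The value at `Y = θ ^ (q ^ (-m))` is reduced modulo `P` to the reduction of the value at
`Y = θ ^ (q ^ (deg P - m))`. -/
theorem iotaPoly_evalY (m : ℕ) (N : (MvPolynomial (Fin s) F[X])[X]) :
    iotaPoly F s (evalY (toKperf F) (thetaRoot F m) N) = famMk F (Fs F s) fun P =>
      intRed s P (substY s (Fintype.card F ^ (P.1.natDegree - m)) N) := by
  have h : (iotaPoly F s).comp (evalY (toKperf F) (thetaRoot F m)) =
      (famMk F (Fs F s)).comp (RingHom.pi fun P =>
        (intRed s P).comp (substY s (Fintype.card F ^ (P.1.natDegree - m)))) := by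
    refine Polynomial.ringHom_ext' (MvPolynomial.ringHom_ext (fun a => ?_) fun i => ?_) ?_
    · simp only [RingHom.comp_apply, evalY, coe_eval₂RingHom, eval₂_C, MvPolynomial.map_C,
        iotaPoly_C_toKperf]
      refine congrArg _ (funext fun P => ?_)
      simp [substY, intRed_C]
    · simp only [RingHom.comp_apply, evalY, coe_eval₂RingHom, eval₂_C, MvPolynomial.map_X,
        iotaPoly_X]
      refine congrArg _ (funext fun P => ?_)
      simp [substY, intRed_X]
    · simp only [RingHom.comp_apply, evalY, coe_eval₂RingHom, eval₂_X, iotaPoly_C_thetaRoot]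
      refine congrArg _ (funext fun P => ?_)
      simp [substY, intRed_C]
  exact congr($h N)

theorem iota_algebraMap (f : MvPolynomial (Fin s) (Kperf F)) :
    iota F s (algebraMap _ (PerfFrac F s) f) = iotaPoly F s f :=
  IsLocalization.lift_eq _ f

/-- `b_{deg P - m}(t_i) ∏_{j = 1}^m (t_i - θ ^ (q ^ (deg P - j))) = P(t_i)` modulo `P`. -/
theorem famMk_intB_mul (m : ℕ) (i : Fin s) :
    (famMk F (Fs F s) fun P => intRed s P (intB F (P.1.natDegree - m) i)) *
        iotaPoly F s (∏ j ∈ Finset.Icc 1 m,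
          (MvPolynomial.X i - MvPolynomial.C (thetaRoot F j))) =
      ((hatOmega F i)⁻¹ : (ResRing F (Fs F s))ˣ) := by
  have h : iotaPoly F s (∏ j ∈ Finset.Icc 1 m,
      (MvPolynomial.X i - MvPolynomial.C (thetaRoot F j))) = famMk F (Fs F s) fun P =>
        ∏ j ∈ Finset.Icc 1 m,
          (resMk P (C (tVar F i)) - resMk P X ^ Fintype.card F ^ (P.1.natDegree - j)) := by
    rw [map_prod]
    simp only [map_sub, iotaPoly_X, iotaPoly_C_thetaRoot]
    simp only [← map_sub, ← map_prod]
    refine congrArg _ (funext fun P => ?_)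
    rw [Finset.prod_apply]
    rfl
  rw [h, ← map_mul]
  change _ = famMk F (Fs F s) fun P => resMk P (C (aeval (tVar F i) P.1))
  rw [famMk_eq_iff]
  refine (finite_natDegree_lt m).subset fun P hP => ?_
  by_contra hm
  refine hP ?_
  rw [Set.mem_ofPred_eq, not_lt] at hm
  obtain ⟨n, hn⟩ := Nat.exists_eq_add_of_le' hm
  rw [Pi.mul_apply, resMk_C_aeval, intRed_intB, hn, Nat.add_sub_cancel, Finset.prod_range_add]
  congr 1
  rw [← Finset.prod_range_reflect]
  have hIcc := Finset.prod_Ico_add' (fun j => (resMk P (C (tVar F i)) -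
    resMk P X ^ Fintype.card F ^ (n + m - j) : Res F (Fs F s) P)) 0 m 1
  rw [← Finset.range_eq_Ico] at hIcc
  refine hIcc.symm.trans (Finset.prod_congr rfl fun j hj => ?_)
  rw [Finset.mem_range] at hj
  rw [show n + m - (j + 1) = n + (m - 1 - j) by omega]

end Iota

/-! ### The finite zeta value -/

theorem muDenom_ne_zero (F : Type*) [Field F] [Fintype F] (s : ℕ) : muDenom F s ≠ 0 := by
  refine (map_ne_zero_iff _ (IsFractionRing.injective _ _)).2 ?_
  refine Finset.prod_ne_zero_iff.2 fun i _ => Finset.prod_ne_zero_iff.2 fun j _ => ?_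
  rw [sub_ne_zero]
  intro h0
  exact varVal_ne_constVal (Kperf F) i (thetaRoot F j) (congrArg (algebraMap _ _) h0)

/-- The finite zeta value in terms of the value of an interpolating fraction. -/
theorem finiteZeta_eq {F : Type*} [Field F] [Fintype F] {s : ℕ} {H : RatYT F s}
    (hH : Interpolates H) {h : PerfFrac F s}
    (hh : HasValue (toKperf F) (thetaRoot F (mOf F s)) H h) :
    finiteZeta F 1 s =
      ↑(hatPi F (Fs F s) * (∏ i : Fin s, hatOmega F i)⁻¹ : (ResRing F (Fs F s))ˣ) *
        iota F s (-h / muDenom F s) := by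
  obtain ⟨N, D, hD, hHND, rfl⟩ := hh
  obtain ⟨hD1, hD2⟩ := algebraMap_evalY_ne_zero hD
  have hND : H * algebraMap _ _ D = algebraMap _ _ N := by
    rw [hHND, div_mul_cancel₀ _ hD2]
  -- the congruences modulo all `P`, collected in one identity
  have h1 : finiteZeta F 1 s *
      (famMk F (Fs F s) fun P => resMk P ((derivative P.1).map (algebraMap F (Fs F s)))) *
      iotaPoly F s (evalY (toKperf F) (thetaRoot F (mOf F s)) D) =
      (∏ i, famMk F (Fs F s) fun P => intRed s P (intB F (P.1.natDegree - mOf F s) i)) *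
        iotaPoly F s (evalY (toKperf F) (thetaRoot F (mOf F s)) N) := by
    rw [iotaPoly_evalY, iotaPoly_evalY, finiteZeta, ← map_mul, ← map_mul, ← map_prod, ← map_mul,
      famMk_eq_iff]
    refine (finite_natDegree_lt (mOf F s)).subset fun P hP => ?_
    by_contra hm
    refine hP ?_
    rw [Set.mem_ofPred_eq, not_lt] at hm
    simp only [Pi.mul_apply, Finset.prod_apply]
    exact redPoly_harmonicSum_mul hH hND P hm
  have hμ := muDenom_ne_zero F s
  -- the product of the `b_{deg P - m}(t_i)` times the denominator of `μ` is the inverse of the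
  -- product of the `ω̂(t_i)`
  have h2 : (∏ i, famMk F (Fs F s) fun P => intRed s P (intB F (P.1.natDegree - mOf F s) i)) *
      iota F s (muDenom F s) =
        (((∏ i : Fin s, hatOmega F i)⁻¹ : (ResRing F (Fs F s))ˣ) : ResRing F (Fs F s)) := by
    rw [muDenom, iota_algebraMap, map_prod, ← Finset.prod_mul_distrib,
      Finset.prod_congr rfl fun i _ => famMk_intB_mul (mOf F s) i, ← Finset.prod_inv_distrib,
      Units.coe_prod]
  -- `P' π̂ = -1`
  have h3 : (famMk F (Fs F s) fun P => resMk P ((derivative P.1).map (algebraMap F (Fs F s)))) *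
      (hatPi F (Fs F s) : ResRing F (Fs F s)) = -1 := by
    have h := (hatPi F (Fs F s)).inv_mul
    change (famMk F (Fs F s) fun P =>
      -resMk P ((derivative P.1).map (algebraMap F (Fs F s)))) * _ = 1 at h
    change famMk F (Fs F s) (-fun P =>
      resMk P ((derivative P.1).map (algebraMap F (Fs F s)))) * _ = 1 at h
    rw [map_neg] at h
    linear_combination -h
  have h4 : iota F s (-(algebraMap _ _ (evalY (toKperf F) (thetaRoot F (mOf F s)) N) /
      algebraMap _ _ (evalY (toKperf F) (thetaRoot F (mOf F s)) D)) / muDenom F s) *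
      (iota F s (muDenom F s) * iotaPoly F s (evalY (toKperf F) (thetaRoot F (mOf F s)) D)) =
      -iotaPoly F s (evalY (toKperf F) (thetaRoot F (mOf F s)) N) := by
    rw [← iota_algebraMap, ← iota_algebraMap, ← map_mul, ← map_mul, ← RingHom.map_neg]
    congr 1
    field_simp
  have hu1 : IsUnit (iota F s (muDenom F s)) := (IsUnit.mk0 _ hμ).map (iota F s)
  have hu2 : IsUnit (iotaPoly F s (evalY (toKperf F) (thetaRoot F (mOf F s)) D)) :=
    iotaPoly_isUnit hD
  have hu3 : IsUnit (famMk F (Fs F s) fun P =>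
      resMk P ((derivative P.1).map (algebraMap F (Fs F s)))) :=
    IsUnit.of_mul_eq_one (-(hatPi F (Fs F s) : ResRing F (Fs F s))) (by
      rw [mul_neg, h3, neg_neg])
  refine (hu1.mul (hu2.mul hu3)).mul_right_cancel ?_
  rw [Units.val_mul]
  linear_combination iota F s (muDenom F s) * h1 +
    iotaPoly F s (evalY (toKperf F) (thetaRoot F (mOf F s)) N) * h2 -
    (((∏ i : Fin s, hatOmega F i)⁻¹ : (ResRing F (Fs F s))ˣ) : ResRing F (Fs F s)) *
      iota F s (-(algebraMap _ _ (evalY (toKperf F) (thetaRoot F (mOf F s)) N) /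
        algebraMap _ _ (evalY (toKperf F) (thetaRoot F (mOf F s)) D)) / muDenom F s) *
      (iota F s (muDenom F s) *
        iotaPoly F s (evalY (toKperf F) (thetaRoot F (mOf F s)) D)) * h3 +
    (((∏ i : Fin s, hatOmega F i)⁻¹ : (ResRing F (Fs F s))ˣ) : ResRing F (Fs F s)) * h4

end FinZeta

end

open FinZeta in
theorem theorem1p6 (F : Type*) [Field F] [Fintype F] (s : ℕ) (hs : 1 ≤ s)
    (hmod : s ≡ 1 [MOD Fintype.card F - 1]) :
    ∃ H : RatYT F s, Interpolates H ∧ (∀ H' : RatYT F s, Interpolates H' → H' = H) ∧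
      ∃ h μ : PerfFrac F s, HasValue (toKperf F) (thetaRoot F (mOf F s)) H h ∧
        μ = -h / muDenom F s ∧ μ ≠ 0 ∧
        finiteZeta F 1 s =
          ↑(hatPi F (Fs F s) * (∏ i : Fin s, hatOmega F i)⁻¹ : (ResRing F (Fs F s))ˣ) *
            iota F s μ ∧
        IsUnit (finiteZeta F 1 s) := by
  obtain ⟨H, hH, h, hh, h0⟩ := exists_interpolates hs hmod
  have hμ : -h / muDenom F s ≠ 0 := div_ne_zero (neg_ne_zero.2 h0) (muDenom_ne_zero F s)
  have hZ := finiteZeta_eq hH hh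
  refine ⟨H, hH, fun H' hH' => hH.unique hH', h, -h / muDenom F s, hh, rfl, hμ, hZ, ?_⟩
  rw [hZ]
  exact (Units.isUnit _).mul ((IsUnit.mk0 _ hμ).map (iota F s))
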